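/- Let $\Omega$ be a (finite-dimensional, smooth, boundaryless) Riemannian manifold with Riemannian distance, $B_r(z)$ its open metric balls, and $T:\Omega\to\Omega$ a $C^{1+\zeta}$ map for some $\zeta\in(0,1]$ (i.e. $T$ is $C^1$ and in charts its derivative is locally $\zeta$-Hölder). Let $\mu$ be a $T$-invariant Borel probability measure and $\mathcal A=\{A_j\}_{j\in\mathbb N}$ a countable measurable partition of $\Omega$; write $\mathcal A^n=\bigvee_{i=0}^{n-1}T^{-i}\mathcal A$, whose elements are the $n$-cylinders. Suppose that $\mu$ is right $\phi$-mixing with respect to $\mathcal A$: there is a decreasing $\phi$ with $\phi(k)\to0$ such that $$|\mu(S\cap T^{-n-k}B)-\mu(S)\mu(B)|\le\phi(k)\,\mu(B)$$ for all $n,k$, all $S\in\sigma(\mathcal A^n)$ and all $B\in\sigma(\bigcup_j\mathcal A^j)$; and that $\phi(k)=O(k^{-m})$ for some $m>0$. Suppose also that there are constants $c_1,\kappa'$, $v>1$ and $d>0$ with $\kappa' d/v>1$ such that (i) every $n$-cylinder has diameter at most $c_1n^{-\kappa'}$, for all $n\ge1$; (ii) $\lim_{r\to0}\mu(B_{r+r^v}(z))/\mu(B_r(z))=1$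 for all $z\in\Omega$; (iii) $\mu(B_r(z))=O(r^d)$ as $r\to0$, for all $z\in\Omega$. For each $r>0$ choose an integer $n(r)\ge1$ with $n(r)^{-\kappa'}\le r^v$, and let $U_r^-$ (resp. $U_r^+$) be the union of the $n(r)$-cylinders contained in $B_r(z)$ (resp. meeting $B_r(z)$). If $z$ is periodic with prime period $p$, assume that each of the families $U_r=U_r^-$ and $U_r=U_r^+$ satisfies the following condition: there are $a_r\in(0,1)$ with $a_r\,n(r)\to\infty$ and $e_r\to0$ as $r\to0$ such that $$\Bigl|\mu\Bigl(\bigcap_{j=0}^{l}T^{-i_j}U_r\Bigr)-\mu\bigl(U_{r,i_l/p}\bigr)\Bigr|\le e_r\,\mu\bigl(U_{r,i_l/p}\bigr),\qquad U_{r,u}:=\bigcap_{j=0}^{u}T^{-pj}U_r,$$ for all $r>0$, all $l\ge0$ and all multiples $0=i_0<i_1<\dots<i_l\le a_r\,n(r)$ of $p$; and assume that the limit $\theta=\theta(z)=\lim_{r\to0}\mu(B_r(z)\cap T^{-p}B_r(z))/\mu(B_r(z))$ exists and $\theta<\tfrac12$. Let $\tau_U(x)=\inf\{j\ge1:T^jx\in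 U\}$ be the hitting time, and set $L=1$ if $z$ is not periodic and $L=1-\theta$ if $z$ is periodic. Then, for every $z\in\Omega$ as above: (a) for every $\alpha\in(0,\infty)$ such that $m>\frac{1-\epsilon}{\beta\epsilon}$ for some $\epsilon\in(0,\min(1,\alpha))$ and some $\beta\in(0,1)$, and for every $s>0$, $$\lim_{r\to0}\frac{-1}{s\,\mu(B_r(z))^{1-\alpha}}\log\mu\bigl(\tau_{B_r(z)}>s\,\mu(B_r(z))^{-\alpha}\bigr)=L;$$ (b) for $\alpha=0$, the limits $\ell(s)=\lim_{r\to0}\frac{-1}{s\,\mu(B_r(z))}\log\mu(\tau_{B_r(z)}>s)$ exist for all $s>0$, and $\lim_{s\to\infty}\ell(s)=L$. -/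

import Mathlib

open Set Filter Topology MeasureTheory
open scoped ENNReal Manifold ContDiff Bundle

noncomputable section

namespace HittingStats

section Manifold

/-- `T` is of class `C^{1+ζ}` (with `0 < ζ ≤ 1`): it is `C¹`, and, read in charts, its derivative is
locally `ζ`-Hölder continuous. -/
def IsC1Holder (k : ℕ) {Ω : Type*} [TopologicalSpace Ω]
    [ChartedSpace (EuclideanSpace ℝ (Fin k)) Ω] (ζ : ℝ) (T : Ω → Ω) : Prop :=
  ContMDiff (𝓡 k) (𝓡 k) 1 T ∧
    ∀ x : Ω, ∃ C : ℝ, ∃ V ∈ 𝓝 (extChartAt (𝓡 k) x x), ∀ u ∈ V, ∀ w ∈ V,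
      ‖fderiv ℝ (writtenInExtChartAt (𝓡 k) (𝓡 k) x T) u
          - fderiv ℝ (writtenInExtChartAt (𝓡 k) (𝓡 k) x T) w‖ ≤ C * ‖u - w‖ ^ ζ

end Manifold

section Partition

/-- A countable measurable partition `{A₀, A₁, …}` of `Ω`. Empty pieces are allowed, so that finite
partitions are included. -/
structure IsMeasurablePartition {Ω : Type*} [MeasurableSpace Ω] (A : ℕ → Set Ω) : Prop where
  measurableSet : ∀ i, MeasurableSet (A i)
  disjoint : Pairwise fun i j => Disjoint (A i) (A j)
  iUnion_eq : ⋃ i, A i = univ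

/-- The `n`-cylinders, that is, the elements of the join `𝒜ⁿ = ⋁_{i<n} T⁻ⁱ𝒜`. -/
def cylinders {Ω : Type*} (T : Ω → Ω) (A : ℕ → Set Ω) (n : ℕ) : Set (Set Ω) :=
  range fun w : Fin n → ℕ => ⋂ i : Fin n, T^[(i : ℕ)] ⁻¹' A (w i)

/-- `σ(𝒜ⁿ)`. -/
abbrev cylinderAlgebra {Ω : Type*} (T : Ω → Ω) (A : ℕ → Set Ω) (n : ℕ) : MeasurableSpace Ω :=
  MeasurableSpace.generateFrom (cylinders T A n)

/-- `σ(⋃ⱼ 𝒜ʲ)`. -/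
abbrev cylinderAlgebraTop {Ω : Type*} (T : Ω → Ω) (A : ℕ → Set Ω) : MeasurableSpace Ω :=
  MeasurableSpace.generateFrom (⋃ j : ℕ, cylinders T A j)

/-- `μ` is right `φ`-mixing with respect to the partition `A`. -/
structure IsRightPhiMixing {Ω : Type*} [MeasurableSpace Ω] (μ : Measure Ω) (T : Ω → Ω)
    (A : ℕ → Set Ω) (φ : ℕ → ℝ) : Prop where
  antitone : Antitone φ
  tendsto_zero : Tendsto φ atTop (𝓝 0)
  mixing : ∀ (n j : ℕ) (S B : Set Ω), MeasurableSet[cylinderAlgebra T A n] S →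
    MeasurableSet[cylinderAlgebraTop T A] B →
      |μ.real (S ∩ T^[n + j] ⁻¹' B) - μ.real S * μ.real B| ≤ φ j * μ.real B

end Partition

section Balls

/-- The open ball `B_r(z)` of the (extended) distance. -/
def rball {Ω : Type*} [EMetricSpace Ω] (z : Ω) (r : ℝ) : Set Ω :=
  Metric.eball z (ENNReal.ofReal r)

/-- The inner approximation `U_n⁻` of `B_r(z)`: the union of the `n`-cylinders inside it. -/
def innerApprox {Ω : Type*} [EMetricSpace Ω] (T : Ω → Ω) (A : ℕ → Set Ω) (z : Ω) (n : ℕ) (r : ℝ) :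
    Set Ω :=
  ⋃₀ {C | C ∈ cylinders T A n ∧ C ⊆ rball z r}

/-- The outer approximation `U_n⁺` of `B_r(z)`: the union of the `n`-cylinders that meet it. -/
def outerApprox {Ω : Type*} [EMetricSpace Ω] (T : Ω → Ω) (A : ℕ → Set Ω) (z : Ω) (n : ℕ) (r : ℝ) :
    Set Ω :=
  ⋃₀ {C | C ∈ cylinders T A n ∧ (C ∩ rball z r).Nonempty}

end Balls

section Recurrence

/-- `U_{·,u} = ⋂_{j=0}^u T^{-pj} U`. -/
def iterInter {Ω : Type*} (T : Ω → Ω) (p : ℕ) (U : Set Ω) (u : ℕ) : Set Ω :=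
  ⋂ j ∈ Finset.range (u + 1), T^[p * j] ⁻¹' U

/-- The condition on the returns to a family `U r` (`r → 0⁺`), with `U r ∈ σ(𝒜^{N r})`, around a
point of prime period `p`: there are `a r ∈ (0,1)` with `a r * N r → ∞` and `e r → 0` such that
`μ(⋂_{j=0}^l T^{-i_j} U r) = μ(U_{r, i_l / p}) (1 + O*(e r))`, where `|O*(e)| ≤ e`, for all multiples
`0 = i_0 < ⋯ < i_l ≤ a r * N r` of `p`. -/
def NestedReturns {Ω : Type*} [MeasurableSpace Ω] (μ : Measure Ω) (T : Ω → Ω) (p : ℕ)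
    (N : ℝ → ℕ) (U : ℝ → Set Ω) : Prop :=
  ∃ a e : ℝ → ℝ, (∀ r, 0 < r → 0 < a r ∧ a r < 1) ∧
    Tendsto (fun r => a r * (N r : ℝ)) (𝓝[>] 0) atTop ∧
    Tendsto e (𝓝[>] 0) (𝓝 0) ∧
    ∀ r, 0 < r → ∀ (l : ℕ) (i : Fin (l + 1) → ℕ), i 0 = 0 → StrictMono i → (∀ j, p ∣ i j) →
      (i (Fin.last l) : ℝ) ≤ a r * (N r : ℝ) →
        |μ.real (⋂ j, T^[i j] ⁻¹' U r) - μ.real (iterInter T p (U r) (i (Fin.last l) / p))|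
          ≤ e r * μ.real (iterInter T p (U r) (i (Fin.last l) / p))

/-- The hitting time `τ_U(x) = inf {j ≥ 1 : T^j x ∈ U}`, equal to `∞` if the orbit never hits. -/
def hittingTime {Ω : Type*} (T : Ω → Ω) (U : Set Ω) (x : Ω) : ℕ∞ :=
  ⨅ (j : ℕ) (_ : 1 ≤ j ∧ T^[j] x ∈ U), (j : ℕ∞)

/-- `μ(τ_U > t)`. -/
def survival {Ω : Type*} [MeasurableSpace Ω] (μ : Measure Ω) (T : Ω → Ω) (U : Set Ω) (t : ℝ) : ℝ :=
  μ.real {x | ENNReal.ofReal t < (hittingTime T U x : ℝ≥0∞)}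

/-- `-1 / (s μ(U)^{1-α}) * log μ(τ_U > s μ(U)^{-α})`. -/
def recurrenceRate {Ω : Type*} [MeasurableSpace Ω] (μ : Measure Ω) (T : Ω → Ω) (α s : ℝ)
    (U : Set Ω) : ℝ :=
  -1 / (s * μ.real U ^ (1 - α)) * Real.log (survival μ T U (s * μ.real U ^ (-α)))

/-- `L_{α,s}(z) = L` along metric balls, for `α > 0` (the limit `r → 0` with `s` fixed). -/
def HasRecurrenceLimit {Ω : Type*} [EMetricSpace Ω] [MeasurableSpace Ω] (μ : Measure Ω)
    (T : Ω → Ω) (z : Ω) (α s L : ℝ) : Prop :=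
  Tendsto (fun r => recurrenceRate μ T α s (rball z r)) (𝓝[>] 0) (𝓝 L)

/-- `L_0(z) = L` along metric balls: for `α = 0` the limit is the iterated one,
`lim_{s → ∞} lim_{r → 0} -1 / (s μ(B_r)) * log μ(τ_{B_r} > s)`; all inner limits exist. -/
def HasRecurrenceLimitZero {Ω : Type*} [EMetricSpace Ω] [MeasurableSpace Ω] (μ : Measure Ω)
    (T : Ω → Ω) (z : Ω) (L : ℝ) : Prop :=
  ∃ ℓ : ℝ → ℝ, (∀ s, 0 < s → HasRecurrenceLimit μ T z 0 s (ℓ s)) ∧ Tendsto ℓ atTop (𝓝 L)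

end Recurrence

end HittingStats

end

open Set Filter Topology MeasureTheory
open scoped ENNReal Manifold ContDiff Bundle

noncomputable section

namespace HittingStats

/-! ### Cylinders and the σ-algebras they generate. -/

section Cylinders

variable {Ω : Type*} {T : Ω → Ω} {A : ℕ → Set Ω}

/-! Write M = μ(U), g(t) = μ(τ_U > t) and a_i = μ(U ∩ {τ_U > i}). Invariance gives a_i = g(i) -
g(i+1), hence 1 - g(t) = ∑_{i<t} a_i. The constant L is the extremal index: the limit of a_J / M
along balls shrinking to z, for J large. At a non-periodic point it is 1, since by continuity small
balls do not return within J steps. At a point of period p the returns within J ≥ p steps occur at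
multiples of p, and the nested-return condition makes a return at pu without a return at p
negligible, so the index is 1 - θ (`tendsto_inter_avoid_of_periodic`).

Mixing shows that a_i stays near a_J for i > J, with a defect of at most (δ + (i - J)M)M. The proof
reverses time: the later visit to U is the future event, so the mixing error is φ(J/2)M, and earlier
visits are visits to coarser neighbourhoods of U whose measures have a small sum, because κ'd > v >
1 (`measureReal_inter_avoid_sub_le`, `eventually_cluster_le`). Thus 1 - g(t) is LtM to first order
(`hasFirstOrder_avoid`).

If tM → 0, taking logarithms finishes the argument. If tM stays bounded below, time is cut into
blocks of length about η/M separated by gaps about η²/M. One block is described by the first-order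
estimate, and mixing makes g multiplicative over blocks with errors relative to g itself, so they do
not accumulate against an exponentially small survival probability (`tendsto_neg_log_div_of_le`).

Balls are not cylinder sets, so for α > 0 they are squeezed between inner and outer approximations,
whose measures agree to first order by the annulus condition. For α = 0 the time is fixed as r → 0,
and the iterated limit is a Cesàro mean of the limits of a_i / M. -/

lemma measurableSet_preimage_piece (hA : ⋃ i, A i = univ) {n i : ℕ} (hi : i < n) (j : ℕ) :
    MeasurableSet[cylinderAlgebra T A n] (T^[i] ⁻¹' A j) := by
  have : T^[i] ⁻¹' A j = ⋃ w : {w : Fin n → ℕ // w ⟨i, hi⟩ = j},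
      ⋂ i : Fin n, T^[(i : ℕ)] ⁻¹' A (w.1 i) := by
    ext x
    simp only [mem_preimage, mem_iUnion, mem_iInter]
    constructor
    · intro hx
      have hc : ∀ y, ∃ i, y ∈ A i := fun y => by
        have : y ∈ ⋃ i, A i := hA ▸ mem_univ y
        simpa using this
      choose f hf using hc
      refine ⟨⟨fun l => if l = ⟨i, hi⟩ then j else f (T^[(l : ℕ)] x), by simp⟩, fun l => ?_⟩
      by_cases hl : l = ⟨i, hi⟩
      · subst hl; simpa using hx
      · simpa [hl] using hf _
    · rintro ⟨⟨w, hw⟩, h⟩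
      simpa [hw] using h ⟨i, hi⟩
  rw [this]
  refine @MeasurableSet.iUnion _ _ (cylinderAlgebra T A n) _ _ fun w => ?_
  exact MeasurableSpace.measurableSet_generateFrom ⟨w.1, rfl⟩

lemma cylinderAlgebra_le {M : MeasurableSpace Ω} {n : ℕ}
    (h : ∀ i < n, ∀ j, MeasurableSet[M] (T^[i] ⁻¹' A j)) : cylinderAlgebra T A n ≤ M := by
  refine MeasurableSpace.generateFrom_le ?_
  rintro _ ⟨w, rfl⟩
  exact @MeasurableSet.iInter _ _ M _ _ fun i => h i i.2 _

lemma cylinderAlgebra_mono (hA : ⋃ i, A i = univ) {n n' : ℕ} (h : n ≤ n') :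
    cylinderAlgebra T A n ≤ cylinderAlgebra T A n' :=
  cylinderAlgebra_le fun _ hi j => measurableSet_preimage_piece hA (hi.trans_le h) j

lemma cylinderAlgebra_le_top (n : ℕ) : cylinderAlgebra T A n ≤ cylinderAlgebraTop T A :=
  MeasurableSpace.generateFrom_mono (subset_iUnion _ n)

lemma cylinderAlgebra_le_measurable [M : MeasurableSpace Ω] (hT : Measurable T)
    (hA : ∀ i, MeasurableSet (A i)) (n : ℕ) : cylinderAlgebra T A n ≤ M :=
  cylinderAlgebra_le fun i _ j => hT.iterate i (hA j)

lemma measurableSet_preimage_iterate (hA : ⋃ i, A i = univ) {n i n' : ℕ} (h : i + n ≤ n')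
    {S : Set Ω} (hS : MeasurableSet[cylinderAlgebra T A n] S) :
    MeasurableSet[cylinderAlgebra T A n'] (T^[i] ⁻¹' S) := by
  have : cylinderAlgebra T A n ≤ (cylinderAlgebra T A n').map T^[i] := by
    refine cylinderAlgebra_le fun l hl j => ?_
    rw [MeasurableSpace.map_def, ← preimage_comp, ← Function.iterate_add]
    exact measurableSet_preimage_piece hA (by omega) j
  exact this _ hS

lemma countable_cylinders (n : ℕ) : (cylinders T A n).Countable := countable_range _

lemma exists_mem_cylinders (hA : ⋃ i, A i = univ) (n : ℕ) (x : Ω) :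
    ∃ C ∈ cylinders T A n, x ∈ C := by
  have hc : ∀ y, ∃ i, y ∈ A i := fun y => by
    have : y ∈ ⋃ i, A i := hA ▸ mem_univ y
    simpa using this
  choose f hf using hc
  exact ⟨_, ⟨fun i => f (T^[(i : ℕ)] x), rfl⟩, mem_iInter.2 fun i => hf _⟩

end Cylinders

/-! ### Survival probabilities: invariance, time reversal and mixing. -/

section Avoid

variable {Ω : Type*} {T : Ω → Ω} {A : ℕ → Set Ω}

/-- The points whose orbit avoids `U` at the times `1, …, t`. -/
def avoid (T : Ω → Ω) (U : Set Ω) (t : ℕ) : Set Ω := {x | ∀ j, 1 ≤ j → j ≤ t → T^[j] x ∉ U}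

lemma avoid_anti_set {U V : Set Ω} (h : U ⊆ V) (t : ℕ) : avoid T V t ⊆ avoid T U t :=
  fun _ hx j h1 h2 hU => hx j h1 h2 (h hU)

lemma avoid_anti {U : Set Ω} {s t : ℕ} (h : s ≤ t) : avoid T U t ⊆ avoid T U s :=
  fun _ hx j h1 h2 => hx j h1 (h2.trans h)

@[simp] lemma avoid_zero (U : Set Ω) : avoid T U 0 = univ :=
  eq_univ_of_forall fun _ j h1 h2 => by omega

lemma avoid_eq_biInter (U : Set Ω) (t : ℕ) :
    avoid T U t = ⋂ j ∈ Finset.Icc 1 t, (T^[j] ⁻¹' U)ᶜ := by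
  ext x; simp [avoid]

lemma measurableSet_avoid [MeasurableSpace Ω] (hT : Measurable T) {U : Set Ω}
    (hU : MeasurableSet U) (t : ℕ) : MeasurableSet (avoid T U t) := by
  rw [avoid_eq_biInter]
  exact Finset.measurableSet_biInter _ fun j _ => (hT.iterate j hU).compl

lemma measurableSet_cylinderAlgebra_avoid (hA : ⋃ i, A i = univ) {U : Set Ω} {n : ℕ}
    (hU : MeasurableSet[cylinderAlgebra T A n] U) (t : ℕ) :
    MeasurableSet[cylinderAlgebra T A (t + n)] (avoid T U t) := by
  rw [avoid_eq_biInter]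
  refine @Finset.measurableSet_biInter _ _ (cylinderAlgebra T A (t + n)) _ _ fun j hj => ?_
  refine @MeasurableSet.compl _ _ (cylinderAlgebra T A (t + n)) ?_
  exact measurableSet_preimage_iterate hA (by have := (Finset.mem_Icc.1 hj).2; omega) hU

lemma iterate_add_apply' (T : Ω → Ω) {i j l : ℕ} (h : l = i + j) (x : Ω) :
    T^[i] (T^[j] x) = T^[l] x := by
  rw [h, Function.iterate_add_apply]

variable [MeasurableSpace Ω] {μ : Measure Ω}

lemma measureReal_preimage_iterate (hμ : MeasurePreserving T μ μ) {S : Set Ω}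
    (hS : MeasurableSet S) (i : ℕ) : μ.real (T^[i] ⁻¹' S) = μ.real S := by
  simp only [Measure.real, (hμ.iterate i).measure_preimage hS.nullMeasurableSet]

lemma survival_eq (U : Set Ω) {t : ℝ} (ht : 0 ≤ t) :
    survival μ T U t = μ.real (avoid T U ⌊t⌋₊) := by
  unfold survival
  congr 1
  ext x
  have key : ∀ N : ℕ∞, (∀ j : ℕ, 1 ≤ j ∧ T^[j] x ∈ U → N ≤ j) ↔ N ≤ hittingTime T U x := fun N => by
    simp [hittingTime]
  -- τ is integer valued or infinite, so exceeding t means being at least ⌊t⌋ + 1.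
  have h1 : ENNReal.ofReal t < (hittingTime T U x : ℝ≥0∞) ↔
      ((⌊t⌋₊ + 1 : ℕ) : ℕ∞) ≤ hittingTime T U x := by
    cases hittingTime T U x with
    | top => simp
    | coe a =>
      simp only [ENat.toENNReal_coe, Nat.cast_le]
      rw [← ENNReal.ofReal_natCast, ENNReal.ofReal_lt_ofReal_iff_of_nonneg ht,
        Nat.succ_le_iff, Nat.floor_lt ht]
  rw [mem_ofPred_eq, h1, ← key]
  simp only [Nat.cast_le, avoid, mem_ofPred_eq]
  constructor
  · intro h j h1 h2 h3
    have := h j ⟨h1, h3⟩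
    omega
  · rintro h j ⟨h1, h2⟩
    by_contra hc
    exact h j h1 (by omega) h2

variable [IsProbabilityMeasure μ]

/-- T⁻¹(avoid t) only forbids visits at times 2, …, t + 1. Removing `avoid T U (t + 1)` from it
leaves the points that visit at time 1, which is T⁻¹(U ∩ avoid t). -/
lemma measureReal_inter_avoid (hμ : MeasurePreserving T μ μ) {U : Set Ω} (hU : MeasurableSet U)
    (t : ℕ) : μ.real (U ∩ avoid T U t) = μ.real (avoid T U t) - μ.real (avoid T U (t + 1)) := by
  have hm := measurableSet_avoid hμ.measurable hU
  rw [← measureReal_preimage_iterate hμ (hm t) 1,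
    ← measureReal_preimage_iterate hμ (hU.inter (hm t)) 1,
    ← measureReal_sdiff]
  · congr 1
    ext x
    simp only [mem_preimage, mem_inter_iff, Set.mem_sdiff]
    constructor
    · rintro ⟨h1, h2⟩
      exact ⟨h2, fun h => h 1 le_rfl (by omega) h1⟩
    · rintro ⟨h1, h2⟩
      refine ⟨by_contra fun h => h2 fun j hj1 hj2 => ?_, h1⟩
      obtain rfl | hj := hj1.eq_or_lt
      · exact h
      · have := h1 (j - 1) (by omega) (by omega)
        rwa [iterate_add_apply' T (l := j) (by omega)] at this
  · intro x hx j hj1 hj2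
    rw [iterate_add_apply' T rfl]
    exact hx _ (by omega) (by omega)
  · exact hm _

/-- Time reversal: a first visit at time t + 1 has the same probability as starting in U and staying
away for t steps, both being g(t) - g(t + 1). -/
lemma measureReal_avoid_inter_preimage (hμ : MeasurePreserving T μ μ) {U : Set Ω}
    (hU : MeasurableSet U) (t : ℕ) :
    μ.real (avoid T U t ∩ T^[t + 1] ⁻¹' U) = μ.real (U ∩ avoid T U t) := by
  have hm := measurableSet_avoid hμ.measurable hU
  rw [measureReal_inter_avoid hμ hU, ← measureReal_sdiff (avoid_anti (Nat.le_succ t)) (hm _)]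
  congr 1
  ext x
  simp only [mem_preimage, mem_inter_iff, Set.mem_sdiff]
  refine and_congr_right fun h1 => ⟨fun h2 h => h _ (by omega) le_rfl h2, fun h2 => ?_⟩
  by_contra h
  refine h2 fun j hj1 hj2 => ?_
  obtain rfl | hj := hj2.eq_or_lt
  · exact h
  · exact h1 j hj1 (by omega)

/-- The mass of `U` that avoids `U` up to time `J` but not up to time `J + e` is controlled by
reversing time: a visit at distance `j` in the past is a visit to a set `V j ⊇ U` that depends on
`j / 2` coordinates only. -/
lemma measureReal_inter_avoid_sub_le {φ : ℕ → ℝ} (hμ : MeasurePreserving T μ μ)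
    (hA : IsMeasurablePartition A) (hmix : IsRightPhiMixing μ T A φ) {U : Set Ω} {n : ℕ}
    (hU : MeasurableSet[cylinderAlgebra T A n] U) {J : ℕ} (V : ℕ → Set Ω)
    (hV : ∀ j, J < j → MeasurableSet[cylinderAlgebra T A (j / 2)] (V j))
    (hUV : ∀ j, J < j → U ⊆ V j) (e : ℕ) :
    μ.real (U ∩ avoid T U J) - μ.real (U ∩ avoid T U (J + e)) ≤
      (∑ h ∈ Finset.range e, μ.real (V (J + 1 + h)) + φ (J / 2)) * μ.real U := by
  have hle := cylinderAlgebra_le_measurable hμ.measurable hA.measurableSet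
  have hU' : MeasurableSet U := hle _ _ hU
  have hm := measurableSet_avoid hμ.measurable hU'
  -- With the reference visit to U placed at time J + e + 1, the index h stands for a visit at
  -- distance J + 1 + h in its past. Since V at distance j uses only j / 2 coordinates, S leaves a
  -- gap of J / 2 before the reference visit, however large n is.
  set S : Set Ω := ⋃ h ∈ Finset.range e, T^[e - h] ⁻¹' V (J + 1 + h) with hS
  have hSm : MeasurableSet[cylinderAlgebra T A (J + e + 1 - J / 2)] S := by
    refine @Finset.measurableSet_biUnion _ _ (cylinderAlgebra T A (J + e + 1 - J / 2)) _ _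
      fun h hh => ?_
    have := Finset.mem_range.1 hh
    exact measurableSet_preimage_iterate hA.iUnion_eq (by omega) (hV _ (by omega))
  have hmx := hmix.mixing _ (J / 2) S U hSm (cylinderAlgebra_le_top n _ hU)
  rw [show J + e + 1 - J / 2 + J / 2 = J + e + 1 by omega] at hmx
  have hSr : μ.real S ≤ ∑ h ∈ Finset.range e, μ.real (V (J + 1 + h)) := by
    refine (measureReal_biUnion_finset_le _ _).trans (Finset.sum_le_sum fun h _ => ?_)
    rw [measureReal_preimage_iterate hμ (hle _ _ (hV _ (by omega)))]
  have hsub : T^[e] ⁻¹' (avoid T U J ∩ T^[J + 1] ⁻¹' U) ⊆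
      (avoid T U (J + e) ∩ T^[J + e + 1] ⁻¹' U) ∪ (S ∩ T^[J + e + 1] ⁻¹' U) := by
    rintro x ⟨h1, h2⟩
    simp only [mem_preimage] at h2
    rw [iterate_add_apply' T (l := J + e + 1) (by omega)] at h2
    by_cases hx : x ∈ avoid T U (J + e)
    · exact Or.inl ⟨hx, h2⟩
    refine Or.inr ⟨?_, h2⟩
    simp only [avoid, mem_ofPred_eq, not_forall, not_not] at hx
    obtain ⟨j, hj1, hj2, hj⟩ := hx
    have hje : j ≤ e := by
      by_contra hcon
      refine h1 (j - e) (by omega) (by omega) ?_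
      rwa [iterate_add_apply' T (l := j) (by omega)]
    refine mem_biUnion (x := e - j) (Finset.mem_coe.2 (Finset.mem_range.2 (by omega))) ?_
    rw [mem_preimage, show e - (e - j) = j by omega]
    exact hUV _ (by omega) hj
  have h3 := (measureReal_mono (μ := μ) hsub).trans (measureReal_union_le _ _)
  rw [measureReal_preimage_iterate hμ ((hm J).inter (hμ.measurable.iterate _ hU')),
    measureReal_avoid_inter_preimage hμ hU', measureReal_avoid_inter_preimage hμ hU'] at h3
  have h4 := (abs_le.1 hmx).2
  have h5 := mul_le_mul_of_nonneg_right hSr (measureReal_nonneg (μ := μ) (s := U))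
  rw [add_mul]
  linarith

lemma measureReal_avoid_add_le {φ : ℕ → ℝ}
    (hA : IsMeasurablePartition A) (hmix : IsRightPhiMixing μ T A φ) {U : Set Ω} {n : ℕ}
    (hU : MeasurableSet[cylinderAlgebra T A n] U) (D k t : ℕ) :
    μ.real (avoid T U (D + (n + k) + t)) ≤
      (μ.real (avoid T U D) + φ k) * μ.real (avoid T U t) := by
  have hm := measurableSet_cylinderAlgebra_avoid hA.iUnion_eq hU
  have hmx := hmix.mixing _ k _ _ (hm D) (cylinderAlgebra_le_top _ _ (hm t))
  have hsub : avoid T U (D + (n + k) + t) ⊆ avoid T U D ∩ T^[D + n + k] ⁻¹' avoid T U t := by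
    intro x hx
    refine ⟨avoid_anti (by omega) hx, fun j hj1 hj2 => ?_⟩
    rw [iterate_add_apply' T rfl]
    exact hx _ (by omega) (by omega)
  have h3 := measureReal_mono (μ := μ) hsub
  have h4 := (abs_le.1 hmx).2
  rw [add_mul]
  linarith

/-- Avoiding before and after the gap fails to be avoidance throughout only through a visit H inside
the gap. To decouple H from the future, the first n + k steps of the second stretch are dropped. The
loss is then proportional to g(t), not merely bounded by a constant. -/
lemma le_measureReal_avoid_add {φ : ℕ → ℝ} (hμ : MeasurePreserving T μ μ)
    (hA : IsMeasurablePartition A) (hmix : IsRightPhiMixing μ T A φ) {U : Set Ω} {n : ℕ}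
    (hU : MeasurableSet[cylinderAlgebra T A n] U) (D k t : ℕ) :
    (μ.real (avoid T U D) - φ k) * μ.real (avoid T U (n + k + t)) -
        (((n + k : ℕ) : ℝ) * μ.real U + φ k) * μ.real (avoid T U t) ≤
      μ.real (avoid T U (D + (n + k) + (n + k + t))) := by
  have hle := cylinderAlgebra_le_measurable hμ.measurable hA.measurableSet
  have hm := measurableSet_cylinderAlgebra_avoid hA.iUnion_eq hU
  have hmx := hmix.mixing _ k _ _ (hm D) (cylinderAlgebra_le_top _ _ (hm (n + k + t)))
  set H : Set Ω := ⋃ j ∈ Finset.range (n + k), T^[D + 1 + j] ⁻¹' U with hH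
  have hHm : MeasurableSet[cylinderAlgebra T A (D + (n + k) + n)] H := by
    refine @Finset.measurableSet_biUnion _ _ (cylinderAlgebra T A (D + (n + k) + n)) _ _
      fun j hj => ?_
    have := Finset.mem_range.1 hj
    exact measurableSet_preimage_iterate hA.iUnion_eq (by omega) hU
  have hHr : μ.real H ≤ ((n + k : ℕ) : ℝ) * μ.real U := by
    refine (measureReal_biUnion_finset_le _ _).trans ?_
    simp [measureReal_preimage_iterate hμ (hle _ _ hU)]
  have hmx' := hmix.mixing _ k _ _ hHm (cylinderAlgebra_le_top _ _ (hm t))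
  have hsub : avoid T U D ∩ T^[D + n + k] ⁻¹' avoid T U (n + k + t) ⊆
      avoid T U (D + (n + k) + (n + k + t)) ∪
        (H ∩ T^[D + (n + k) + n + k] ⁻¹' avoid T U t) := by
    rintro x ⟨h1, h2⟩
    by_cases hx : x ∈ avoid T U (D + (n + k) + (n + k + t))
    · exact Or.inl hx
    refine Or.inr ⟨?_, fun j hj1 hj2 => ?_⟩
    · simp only [avoid, mem_ofPred_eq, not_forall, not_not] at hx
      obtain ⟨j, hj1, hj2, hj⟩ := hx
      have hj3 : D < j := by
        by_contra hcon
        exact h1 j hj1 (by omega) hj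
      have hj4 : j ≤ D + (n + k) := by
        by_contra hcon
        refine h2 (j - (D + n + k)) (by omega) (by omega) ?_
        rwa [iterate_add_apply' T (l := j) (by omega)]
      refine mem_biUnion (x := j - (D + 1)) (Finset.mem_coe.2 (Finset.mem_range.2 (by omega))) ?_
      rwa [mem_preimage, show D + 1 + (j - (D + 1)) = j by omega]
    · rw [iterate_add_apply' T rfl, ← iterate_add_apply' T (i := n + k + j) (j := D + n + k)
        (by omega)]
      exact h2 _ (by omega) (by omega)
  have h3 := (measureReal_mono (μ := μ) hsub).trans (measureReal_union_le _ _)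
  have h4 := (abs_le.1 hmx).1
  have h5 := (abs_le.1 hmx').2
  have h6 := mul_le_mul_of_nonneg_right hHr (measureReal_nonneg (μ := μ) (s := avoid T U t))
  rw [add_mul, sub_mul]
  linarith

lemma one_sub_measureReal_avoid (hμ : MeasurePreserving T μ μ) {U : Set Ω}
    (hU : MeasurableSet U) (t : ℕ) :
    1 - μ.real (avoid T U t) = ∑ i ∈ Finset.range t, μ.real (U ∩ avoid T U i) := by
  simp only [measureReal_inter_avoid hμ hU]
  rw [Finset.sum_range_sub']
  simp

lemma measureReal_avoid_sub_le (hμ : MeasurePreserving T μ μ) {U V : Set Ω}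
    (hU : MeasurableSet U) (hV : MeasurableSet V) (hUV : U ⊆ V) (t : ℕ) :
    μ.real (avoid T U t) - μ.real (avoid T V t) ≤ t * (μ.real V - μ.real U) := by
  have hsub : avoid T U t ⊆ avoid T V t ∪ ⋃ j ∈ Finset.Icc 1 t, T^[j] ⁻¹' (V \ U) := by
    intro x hx
    by_cases h : x ∈ avoid T V t
    · exact Or.inl h
    simp only [avoid, mem_ofPred_eq, not_forall, not_not] at h
    obtain ⟨j, hj1, hj2, hj⟩ := h
    exact Or.inr (mem_biUnion (x := j) (Finset.mem_coe.2 (Finset.mem_Icc.2 ⟨hj1, hj2⟩))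
      ⟨hj, hx j hj1 hj2⟩)
  have h3 := (measureReal_mono (μ := μ) hsub).trans (measureReal_union_le _ _)
  have h5 : μ.real (V \ U) = μ.real V - μ.real U := measureReal_sdiff hUV hU
  have h4 : μ.real (⋃ j ∈ Finset.Icc 1 t, T^[j] ⁻¹' (V \ U)) ≤ t * (μ.real V - μ.real U) := by
    refine (measureReal_biUnion_finset_le _ _).trans ?_
    simp_rw [measureReal_preimage_iterate hμ (hV.diff hU), h5]
    simp [mul_sub]
  linarith

/-- Both masses are increments of survival probabilities, and replacing U by V changes those only
through visits to V \ U. This carries the extremal index from balls to their approximations. -/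
lemma abs_measureReal_inter_avoid_sub_le (hμ : MeasurePreserving T μ μ) {U V : Set Ω}
    (hU : MeasurableSet U) (hV : MeasurableSet V) (hUV : U ⊆ V) (t : ℕ) :
    |μ.real (U ∩ avoid T U t) - μ.real (V ∩ avoid T V t)| ≤
      (t + 1) * (μ.real V - μ.real U) := by
  rw [measureReal_inter_avoid hμ hU, measureReal_inter_avoid hμ hV]
  have h1 := measureReal_avoid_sub_le hμ hU hV hUV t
  have h2 := measureReal_avoid_sub_le hμ hU hV hUV (t + 1)
  have h3 := measureReal_mono (μ := μ) (avoid_anti_set (T := T) hUV t)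
  have h4 := measureReal_mono (μ := μ) (avoid_anti_set (T := T) hUV (t + 1))
  have h5 := measureReal_mono (μ := μ) hUV
  push_cast at h2
  rw [abs_le]
  constructor <;> nlinarith

end Avoid

/-! ### Exponential rates from approximate multiplicativity over blocks. -/

section Blocks

/-- The properties of the survival sequence `g t = μ(τ_U > t)`, `M = μ(U)`, `U ∈ σ(𝒜ⁿ)`, that
determine its exponential rate. -/
structure IsBlockSeq (g : ℕ → ℝ) (M : ℝ) (n : ℕ) (φ : ℕ → ℝ) : Prop where
  zero : g 0 = 1
  anti : Antitone g
  nonneg : ∀ t, 0 ≤ g t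
  step : ∀ t, g t - g (t + 1) ≤ M
  upper : ∀ D k t, g (D + (n + k) + t) ≤ (g D + φ k) * g t
  lower : ∀ D k t, (g D - φ k) * g (n + k + t) - (((n + k : ℕ) : ℝ) * M + φ k) * g t ≤
    g (D + (n + k) + (n + k + t))

namespace IsBlockSeq

variable {g : ℕ → ℝ} {M : ℝ} {n : ℕ} {φ : ℕ → ℝ}

lemma sub_le (h : IsBlockSeq g M n φ) (t w : ℕ) : g t - g (t + w) ≤ w * M := by
  induction w with
  | zero => simp
  | succ w ih =>
    have := h.step (t + w)
    push_cast
    rw [← add_assoc]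
    linarith

/-- Induction on j: the error in `lower` is relative to a survival probability about one block
earlier, and the previous step bounds that by twice the current one. -/
lemma mul_le_succ_block (h : IsBlockSeq g M n φ) {D k : ℕ} {x : ℝ} (hM : 0 ≤ M)
    (hφ : 0 ≤ φ k) (hx : 1 - g D + 3 * φ k + 2 * (((n + k : ℕ) : ℝ) * M) ≤ x) (hx1 : x ≤ 1 / 2)
    (j : ℕ) : (1 - x) * g (j * (D + (n + k))) ≤ g ((j + 1) * (D + (n + k))) := by
  have hw : 0 ≤ ((n + k : ℕ) : ℝ) * M := by positivity
  induction j with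
  | zero =>
    have := h.sub_le D (n + k)
    simp only [zero_mul, h.zero, zero_add, one_mul, mul_one]
    linarith
  | succ j ih =>
    have h1 := h.lower D k (j * (D + (n + k)) + D)
    rw [show n + k + (j * (D + (n + k)) + D) = (j + 1) * (D + (n + k)) by ring,
      show D + (n + k) + (j + 1) * (D + (n + k)) = (j + 1 + 1) * (D + (n + k)) by ring] at h1
    -- Here x ≤ 1/2 enters: one block costs at most a factor 2. This doubles the gap error, giving
    -- 2(n + k)M + 2φ, and the φ of the main term makes 3φ.
    have h2 : g (j * (D + (n + k)) + D) ≤ 2 * g ((j + 1) * (D + (n + k))) := by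
      have h3 : g (j * (D + (n + k)) + D) ≤ g (j * (D + (n + k))) := h.anti (by omega)
      have h4 := h.nonneg (j * (D + (n + k)))
      nlinarith
    have h5 := mul_le_mul_of_nonneg_left h2 (add_nonneg hw hφ)
    have h6 := mul_le_mul_of_nonneg_right hx (h.nonneg ((j + 1) * (D + (n + k))))
    nlinarith

lemma pow_le_block (h : IsBlockSeq g M n φ) {D k : ℕ} {x : ℝ} (hM : 0 ≤ M)
    (hφ : 0 ≤ φ k) (hx : 1 - g D + 3 * φ k + 2 * (((n + k : ℕ) : ℝ) * M) ≤ x) (hx1 : x ≤ 1 / 2)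
    (j : ℕ) : (1 - x) ^ j ≤ g (j * (D + (n + k))) := by
  induction j with
  | zero => simp [h.zero]
  | succ j ih =>
    refine le_trans ?_ (h.mul_le_succ_block hM hφ hx hx1 j)
    rw [pow_succ']
    exact mul_le_mul_of_nonneg_left ih (by linarith)

lemma block_le_pow (h : IsBlockSeq g M n φ) {D k : ℕ} (hφ : 0 ≤ φ k) (j : ℕ) :
    g (j * (D + (n + k))) ≤ (g D + φ k) ^ j := by
  induction j with
  | zero => simp [h.zero]
  | succ j ih =>
    have h1 := h.upper D k (j * (D + (n + k)))
    rw [show D + (n + k) + j * (D + (n + k)) = (j + 1) * (D + (n + k)) by ring] at h1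
    refine h1.trans ?_
    rw [pow_succ']
    exact mul_le_mul_of_nonneg_left ih (add_nonneg (h.nonneg _) hφ)

lemma neg_log_le (h : IsBlockSeq g M n φ) {D k : ℕ} {x : ℝ} (hM : 0 ≤ M)
    (hφ : 0 ≤ φ k) (hx : 1 - g D + 3 * φ k + 2 * (((n + k : ℕ) : ℝ) * M) ≤ x) (hx1 : x ≤ 1 / 2)
    (hx0 : 0 ≤ x) (hD : 0 < D + (n + k)) (t : ℕ) :
    0 < g t ∧ -Real.log (g t) ≤ ((t : ℝ) / (D + (n + k) : ℕ) + 1) * (x / (1 - x)) := by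
  set W := D + (n + k)
  have h1 : (1 - x) ^ (t / W + 1) ≤ g t :=
    (h.pow_le_block hM hφ hx hx1 _).trans (h.anti (by
      rw [mul_comm]; exact (Nat.lt_mul_div_succ t hD).le))
  have h2 : 0 < (1 - x) ^ (t / W + 1) := pow_pos (by linarith) _
  refine ⟨h2.trans_le h1, ?_⟩
  have h3 := Real.log_le_log h2 h1
  rw [Real.log_pow] at h3
  have h4 : -Real.log (1 - x) ≤ x / (1 - x) := by
    have := Real.one_sub_inv_le_log_of_pos (show 0 < 1 - x by linarith)
    have h5 : 1 - (1 - x)⁻¹ = -(x / (1 - x)) := by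
      have : 1 - x ≠ 0 := by linarith
      field_simp
      ring
    linarith
  have h5 : ((t / W : ℕ) : ℝ) ≤ (t : ℝ) / W := Nat.cast_div_le
  have h6 : 0 ≤ x / (1 - x) := div_nonneg hx0 (by linarith)
  calc -Real.log (g t) ≤ ((t / W + 1 : ℕ) : ℝ) * -Real.log (1 - x) := by linarith
    _ ≤ ((t / W + 1 : ℕ) : ℝ) * (x / (1 - x)) := by gcongr
    _ ≤ _ := by push_cast; gcongr

lemma le_neg_log (h : IsBlockSeq g M n φ) {D k : ℕ} {y : ℝ}
    (hφ : 0 ≤ φ k) (hy : y ≤ 1 - (g D + φ k)) (hy0 : 0 ≤ y) (hD : 0 < D + (n + k)) (t : ℕ)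
    (hg : 0 < g t) :
    ((t : ℝ) / (D + (n + k) : ℕ) - 1) * y ≤ -Real.log (g t) := by
  set W := D + (n + k)
  have h1 : g t ≤ (g D + φ k) ^ (t / W) :=
    (h.anti (Nat.div_mul_le_self t W)).trans (h.block_le_pow hφ _)
  have h2 : g t ≤ (1 - y) ^ (t / W) :=
    h1.trans (pow_le_pow_left₀ (add_nonneg (h.nonneg _) hφ) (by linarith) _)
  have h3 : g t ≤ Real.exp (-y) ^ (t / W) := by
    refine h1.trans (pow_le_pow_left₀ (add_nonneg (h.nonneg _) hφ) ?_ _)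
    have := Real.add_one_le_exp (-y)
    linarith
  rw [← Real.exp_nat_mul] at h3
  have h4 := (Real.log_le_iff_le_exp hg).2 h3
  have h5 : (t : ℝ) / W - 1 ≤ ((t / W : ℕ) : ℝ) := by
    have : (t : ℝ) < ((t / W : ℕ) + 1) * W := by
      have := Nat.lt_mul_div_succ t hD
      rw [mul_comm] at this
      exact_mod_cast this
    rw [sub_le_iff_le_add, div_le_iff₀ (by exact_mod_cast hD)]
    exact this.le
  have h6 := mul_le_mul_of_nonneg_right h5 hy0
  linarith

end IsBlockSeq

variable {l : Filter ℝ} {g : ℝ → ℕ → ℝ} {M : ℝ → ℝ} {n : ℝ → ℕ} {φ : ℕ → ℝ} {L : ℝ}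

/-- To second order, `1 - g t = L t M`. -/
def HasFirstOrder (l : Filter ℝ) (g : ℝ → ℕ → ℝ) (M : ℝ → ℝ) (L : ℝ) : Prop :=
  ∀ δ > 0, ∃ J : ℝ, ∀ᶠ r in l, ∀ t : ℕ,
    |1 - g r t - L * (t * M r)| ≤ J * M r + (δ + t * M r) * (t * M r)

/-- Squeeze by 1 - f ≤ -log f ≤ (1 - f) / f, where f → 1. -/
lemma tendsto_neg_log_div {f : ℝ → ℝ} (hM : ∀ᶠ r in l, 0 < M r) (hM0 : Tendsto M l (𝓝 0))
    (hx : Tendsto (fun r => (1 - f r) / M r) l (𝓝 L)) :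
    (∀ᶠ r in l, 0 < f r) ∧ Tendsto (fun r => -Real.log (f r) / M r) l (𝓝 L) := by
  have hx0 : Tendsto (fun r => 1 - f r) l (𝓝 0) := by
    have := hx.mul hM0
    rw [mul_zero] at this
    refine this.congr' ?_
    filter_upwards [hM] with r hM
    field_simp
  have hg : ∀ᶠ r in l, 0 < f r := by
    filter_upwards [hx0.eventually_lt_const one_pos] with r hr
    linarith
  have hg1 : Tendsto f l (𝓝 1) := by
    simpa using (tendsto_const_nhds (x := (1 : ℝ))).sub hx0
  refine ⟨hg, ?_⟩
  have hup : Tendsto (fun r => (1 - f r) / M r / f r) l (𝓝 L) := by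
    rw [← div_one L]
    exact hx.div hg1 one_ne_zero
  refine tendsto_of_tendsto_of_tendsto_of_le_of_le' hx hup ?_ ?_
  · filter_upwards [hM, hg] with r hM hg
    have := Real.log_le_sub_one_of_pos hg
    gcongr
    linarith
  · filter_upwards [hM, hg] with r hM hg
    rw [div_right_comm]
    gcongr
    have := Real.one_sub_inv_le_log_of_pos hg
    rw [sub_div, div_self hg.ne', one_div]
    linarith

lemma tendsto_neg_log_div_of_tendsto_zero (hM : ∀ᶠ r in l, 0 < M r)
    (hB : HasFirstOrder l g M L) {t : ℝ → ℕ} (ht : Tendsto t l atTop)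
    (htM : Tendsto (fun r => t r * M r) l (𝓝 0)) :
    (∀ᶠ r in l, 0 < g r (t r)) ∧
      Tendsto (fun r => -Real.log (g r (t r)) / (t r * M r)) l (𝓝 L) := by
  have ht' : Tendsto (fun r => (t r : ℝ)) l atTop := tendsto_natCast_atTop_atTop.comp ht
  have ht0 : ∀ᶠ r in l, 0 < (t r : ℝ) := ht'.eventually_gt_atTop 0
  have hx : Tendsto (fun r => (1 - g r (t r)) / (t r * M r)) l (𝓝 L) := by
    rw [Metric.tendsto_nhds]
    intro ε hε
    obtain ⟨J, hJ⟩ := hB (ε / 4) (by positivity)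
    have h1 : ∀ᶠ r in l, J / t r < ε / 4 :=
      (ht'.const_div_atTop J).eventually_lt_const (by positivity)
    have h2 := htM.eventually_lt_const (show 0 < ε / 4 by positivity)
    filter_upwards [hM, ht0, hJ, h1, h2] with r hM ht0 hJ h1 h2
    have hp : 0 < t r * M r := by positivity
    rw [Real.dist_eq, div_sub' hp.ne', abs_div, abs_of_pos hp, div_lt_iff₀ hp, mul_comm _ L]
    refine (hJ (t r)).trans_lt ?_
    have h3 : J * M r = J / t r * (t r * M r) := by field_simp
    rw [h3]
    nlinarith
  exact tendsto_neg_log_div (by filter_upwards [hM, ht0] with r h1 h2 using mul_pos h2 h1) htM hx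

set_option maxHeartbeats 800000 in
lemma tendsto_neg_log_div_of_le (hM : ∀ᶠ r in l, 0 < M r) (hM0 : Tendsto M l (𝓝 0))
    (hnM : Tendsto (fun r => n r * M r) l (𝓝 0)) (hφ : Tendsto φ atTop (𝓝 0))
    (hφ0 : ∀ k, 0 ≤ φ k) (hblock : ∀ᶠ r in l, IsBlockSeq (g r) (M r) (n r) φ) (hL : 0 < L)
    (hB : HasFirstOrder l g M L) {t : ℝ → ℕ} {s : ℝ} (hs : 0 < s)
    (htM : ∀ᶠ r in l, s ≤ t r * M r) :
    (∀ᶠ r in l, 0 < g r (t r)) ∧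
      Tendsto (fun r => -Real.log (g r (t r)) / (t r * M r)) l (𝓝 L) := by
  suffices H : ∀ ε > 0, ∀ᶠ r in l, 0 < g r (t r) ∧
      |-Real.log (g r (t r)) / (t r * M r) - L| < ε by
    refine ⟨(H 1 one_pos).mono fun r hr => hr.1, Metric.tendsto_nhds.2 fun ε hε => ?_⟩
    exact (H ε hε).mono fun r hr => hr.2
  intro ε hε
  -- The two main inequalities are the final upper and lower bounds on the rate. The factors 1 - η
  -- and 1 + 2η come from the block length, between (η - η²)/M and (η + 2η²)/M; the term η/s comes
  -- from rounding the number of blocks, since tM ≥ s. All conditions hold in the limit η → 0, so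
  -- continuity supplies η.
  obtain ⟨η, hη0, hη1, hF, hG, hX, hY, hηs⟩ : ∃ η : ℝ, 0 < η ∧ η < 1 ∧
      (1 / (1 - η) + η / s) * ((L + 10 * η) / (1 - (L * η + 10 * η ^ 2))) < L + ε ∧
      L - ε < (1 / (1 + 2 * η) - η / s) * (L - L * η - 4 * η) ∧
      L * η + 10 * η ^ 2 < 1 / 2 ∧ 0 < L - L * η - 4 * η ∧ 0 < 1 / (1 + 2 * η) - η / s := by
    have hc : ∀ {f : ℝ → ℝ} {a b : ℝ}, ContinuousAt f 0 → f 0 = a → a < b →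
        ∀ᶠ η in 𝓝[>] (0 : ℝ), f η < b := fun hf h0 hab =>
      (hf.tendsto.mono_left nhdsWithin_le_nhds).eventually_lt_const (h0 ▸ hab)
    have hc' : ∀ {f : ℝ → ℝ} {a b : ℝ}, ContinuousAt f 0 → f 0 = a → b < a →
        ∀ᶠ η in 𝓝[>] (0 : ℝ), b < f η := fun hf h0 hab =>
      (hf.tendsto.mono_left nhdsWithin_le_nhds).eventually_const_lt (h0 ▸ hab)
    have e1 := hc (f := fun η => (1 / (1 - η) + η / s) *
      ((L + 10 * η) / (1 - (L * η + 10 * η ^ 2)))) (a := L) (b := L + ε)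
      (by fun_prop (disch := norm_num)) (by simp) (by linarith)
    have e2 := hc' (f := fun η => (1 / (1 + 2 * η) - η / s) * (L - L * η - 4 * η)) (a := L)
      (b := L - ε) (by fun_prop (disch := norm_num)) (by simp) (by linarith)
    have e3 := hc (f := fun η => L * η + 10 * η ^ 2) (a := 0) (b := 1 / 2)
      (by fun_prop) (by simp) (by norm_num)
    have e4 := hc' (f := fun η => L - L * η - 4 * η) (a := L) (b := 0)
      (by fun_prop) (by simp) hL
    have e5 := hc' (f := fun η => 1 / (1 + 2 * η) - η / s) (a := 1) (b := 0)
      (by fun_prop (disch := norm_num)) (by simp) one_pos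
    have e6 := hc (f := fun η => η) (a := 0) (b := 1) (by fun_prop) rfl one_pos
    obtain ⟨η, h⟩ := (e1.and (e2.and (e3.and (e4.and (e5.and (e6.and
      (self_mem_nhdsWithin (s := Ioi (0 : ℝ))))))))).exists
    exact ⟨η, h.2.2.2.2.2.2, h.2.2.2.2.2.1, h.1, h.2.1, h.2.2.1, h.2.2.2.1, h.2.2.2.2.1⟩
  obtain ⟨J, hJ⟩ := hB η hη0
  have hη2 : 0 < η ^ 2 := by positivity
  have hk : Tendsto (fun r => ⌊η ^ 2 / M r⌋₊) l atTop := by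
    refine tendsto_nat_floor_atTop.comp ?_
    have : Tendsto M l (𝓝[>] 0) := tendsto_nhdsWithin_iff.2 ⟨hM0, hM⟩
    simpa [div_eq_mul_inv] using this.inv_tendsto_nhdsGT_zero.const_mul_atTop hη2
  have e1 := (hφ.comp hk).eventually_lt_const hη2
  have e2 := hM0.eventually_lt_const hη2
  have e3 := hnM.eventually_lt_const hη2
  have e4 := (by simpa using hM0.const_mul J : Tendsto (fun r => J * M r) l
    (𝓝 0)).eventually_lt_const hη2
  filter_upwards [hM, hblock, hJ, htM, e1, e2, e3, e4] with r hM hb hJ htM e1 e2 e3 e4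
  set D := ⌊η / M r⌋₊ with hD
  set k := ⌊η ^ 2 / M r⌋₊ with hk
  set N := M r
  have d1 : D * N ≤ η := (le_div_iff₀ hM).1 (Nat.floor_le (by positivity))
  have d2 : η - η ^ 2 ≤ D * N := by
    have := (div_lt_iff₀ hM).1 (Nat.lt_floor_add_one (η / N))
    linarith
  have d3 : k * N ≤ η ^ 2 := (le_div_iff₀ hM).1 (Nat.floor_le (by positivity))
  have hw : ((n r + k : ℕ) : ℝ) * N ≤ 2 * η ^ 2 := by push_cast; linarith
  have hw0 : 0 ≤ ((n r + k : ℕ) : ℝ) * N := by positivity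
  have hW : ((D + (n r + k) : ℕ) : ℝ) * N = D * N + ((n r + k : ℕ) : ℝ) * N := by
    push_cast; ring
  have hη3 : 0 < η - η ^ 2 := by nlinarith
  have hWpos : 0 < D + (n r + k) := by
    rcases Nat.eq_zero_or_pos (D + (n r + k)) with h | h
    · rw [h, Nat.cast_zero, zero_mul] at hW; linarith
    · exact h
  have hWpos' : (0 : ℝ) < (D + (n r + k) : ℕ) := by exact_mod_cast hWpos
  have hJD := abs_le.1 (hJ D)
  have hDN0 : 0 ≤ D * N := by positivity
  have f1 : (η + D * N) * (D * N) ≤ 2 * η ^ 2 := by nlinarith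
  have f2 : L * (D * N) ≤ L * η := by gcongr
  have f3 : L * (η - η ^ 2) ≤ L * (D * N) := by gcongr
  have e1' : φ k < η ^ 2 := e1
  -- The first-order estimate costs η² + 2η², the mixing term 3η² and the gap 4η², in all 10η². In
  -- the lower bound below, 4η² is 3η² from the first-order estimate and η² from φ(k).
  have hx : 1 - g r D + 3 * φ k + 2 * (((n r + k : ℕ) : ℝ) * N) ≤ L * η + 10 * η ^ 2 := by
    linarith [hJD.2]
  have hy : η * (L - L * η - 4 * η) ≤ 1 - (g r D + φ k) := by
    nlinarith [hJD.1]
  have htN : 0 < t r * N := hs.trans_le htM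
  obtain ⟨hg, hup⟩ := hb.neg_log_le hM.le (hφ0 k) hx hX.le (by positivity) hWpos (t r)
  have hlow := hb.le_neg_log (hφ0 k) hy (by positivity) hWpos (t r) hg
  refine ⟨hg, ?_⟩
  set W : ℝ := ((D + (n r + k) : ℕ) : ℝ)
  have ht : (t r : ℝ) / W = t r * N / (W * N) := by field_simp
  have hWN : 0 < W * N := by positivity
  rw [abs_lt, lt_sub_iff_add_lt, sub_lt_iff_lt_add, lt_div_iff₀ htN, div_lt_iff₀ htN]
  have hinv : 1 ≤ t r * N / s := by rwa [le_div_iff₀ hs, one_mul]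
  constructor
  · refine lt_of_lt_of_le ?_ hlow
    have h1 : (1 / (1 + 2 * η) - η / s) / η * (t r * N) ≤ t r / W - 1 := by
      have h2 : (1 / (1 + 2 * η) - η / s) / η * (t r * N) =
        t r * N / (η + 2 * η ^ 2) - t r * N / s := by field_simp
      rw [h2, ht]
      have h3 : t r * N / (η + 2 * η ^ 2) ≤ t r * N / (W * N) := by
        gcongr
        linarith
      linarith
    have h4 := mul_le_mul_of_nonneg_right h1 (show 0 ≤ η * (L - L * η - 4 * η) by positivity)
    refine lt_of_lt_of_le ?_ h4
    have h5 := mul_lt_mul_of_pos_right hG htN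
    calc (-ε + L) * (t r * N) = (L - ε) * (t r * N) := by ring
      _ < _ := h5
      _ = _ := by
        generalize (1 / (1 + 2 * η) - η / s) = a
        generalize L - L * η - 4 * η = b
        field_simp
  · refine lt_of_le_of_lt hup ?_
    have h1 : t r / W + 1 ≤ (1 / (1 - η) + η / s) / η * (t r * N) := by
      have hη4 : 1 - η ≠ 0 := by linarith
      have h2 : (1 / (1 - η) + η / s) / η * (t r * N) =
        t r * N / (η - η ^ 2) + t r * N / s := by
        rw [show η - η ^ 2 = η * (1 - η) by ring]
        field_simp
      rw [h2, ht]
      have h3 : t r * N / (W * N) ≤ t r * N / (η - η ^ 2) := by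
        gcongr
        linarith
      linarith
    have h6 : 0 < 1 - (L * η + 10 * η ^ 2) := by linarith
    have h4 := mul_le_mul_of_nonneg_right h1
      (show 0 ≤ (L * η + 10 * η ^ 2) / (1 - (L * η + 10 * η ^ 2)) by positivity)
    refine lt_of_le_of_lt h4 ?_
    have h5 := mul_lt_mul_of_pos_right hF htN
    refine lt_of_eq_of_lt ?_ (h5.trans_eq (by ring))
    generalize (1 / (1 - η) + η / s) = a
    rw [show L * η + 10 * η ^ 2 = η * (L + 10 * η) by ring, div_mul_eq_mul_div, mul_assoc a,
      mul_div_assoc η]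
    generalize (L + 10 * η) / (1 - η * (L + 10 * η)) = b
    field_simp

end Blocks

/-! ### The block inequalities for survival probabilities. -/

section

variable {Ω : Type*} [MeasurableSpace Ω] {μ : Measure Ω} [IsProbabilityMeasure μ] {T : Ω → Ω}
  {A : ℕ → Set Ω} {φ : ℕ → ℝ}

lemma isBlockSeq_avoid (hμ : MeasurePreserving T μ μ) (hA : IsMeasurablePartition A)
    (hmix : IsRightPhiMixing μ T A φ) {U : Set Ω} {n : ℕ}
    (hU : MeasurableSet[cylinderAlgebra T A n] U) :
    IsBlockSeq (fun t => μ.real (avoid T U t)) (μ.real U) n φ where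
  zero := by simp
  anti _ _ h := measureReal_mono (avoid_anti h)
  nonneg _ := measureReal_nonneg
  step t := by
    rw [← measureReal_inter_avoid hμ
      (cylinderAlgebra_le_measurable hμ.measurable hA.measurableSet _ _ hU)]
    exact measureReal_mono inter_subset_left
  upper := measureReal_avoid_add_le hA hmix hU
  lower := le_measureReal_avoid_add hμ hA hmix hU

end

/-! ### Balls and their approximations by cylinders. -/

section Geometry

variable {Ω : Type*} [EMetricSpace Ω] {T : Ω → Ω} {A : ℕ → Set Ω} {z : Ω}

lemma rball_mono {r s : ℝ} (h : r ≤ s) : rball z r ⊆ rball z s :=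
  Metric.eball_subset_eball (ENNReal.ofReal_le_ofReal h)

lemma innerApprox_subset (n : ℕ) (r : ℝ) : innerApprox T A z n r ⊆ rball z r :=
  sUnion_subset fun _ hC => hC.2

lemma subset_outerApprox (hA : ⋃ i, A i = univ) (n : ℕ) (r : ℝ) :
    rball z r ⊆ outerApprox T A z n r := by
  intro x hx
  obtain ⟨C, hC, hxC⟩ := exists_mem_cylinders (T := T) hA n x
  exact ⟨C, ⟨hC, x, hxC, hx⟩, hxC⟩

lemma outerApprox_subset {n : ℕ} {r δ : ℝ} (hr : 0 ≤ r) (hδ : 0 ≤ δ)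
    (hdiam : ∀ C ∈ cylinders T A n, Metric.ediam C ≤ ENNReal.ofReal δ) :
    outerApprox T A z n r ⊆ rball z (r + δ) := by
  rintro x ⟨C, ⟨hC, y, hyC, hy⟩, hxC⟩
  have h1 := (Metric.edist_le_ediam_of_mem hxC hyC).trans (hdiam C hC)
  have h2 : edist y z < ENNReal.ofReal r := hy
  change edist x z < ENNReal.ofReal (r + δ)
  rw [ENNReal.ofReal_add hr hδ, add_comm]
  exact (edist_triangle x y z).trans_lt (ENNReal.add_lt_add_of_le_of_lt (ne_top_of_le_ne_top ENNReal.ofReal_ne_top h1) h1 h2)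

lemma subset_innerApprox (hA : ⋃ i, A i = univ) {n : ℕ} {r δ : ℝ} (hδ : 0 ≤ δ)
    (hdiam : ∀ C ∈ cylinders T A n, Metric.ediam C ≤ ENNReal.ofReal δ) :
    rball z (r - δ) ⊆ innerApprox T A z n r := by
  intro x hx
  have hx' : edist x z < ENNReal.ofReal (r - δ) := hx
  -- The ball contains x, so its radius is not truncated to 0 by `ENNReal.ofReal`.
  have hr : 0 < r - δ := ENNReal.ofReal_pos.1 (bot_le.trans_lt hx')
  obtain ⟨C, hC, hxC⟩ := exists_mem_cylinders (T := T) hA n x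
  refine ⟨C, ⟨hC, fun y hy => ?_⟩, hxC⟩
  have h1 := (Metric.edist_le_ediam_of_mem hy hxC).trans (hdiam C hC)
  change edist y z < ENNReal.ofReal r
  rw [show r = δ + (r - δ) by ring, ENNReal.ofReal_add hδ hr.le]
  exact (edist_triangle y x z).trans_lt (ENNReal.add_lt_add_of_le_of_lt (ne_top_of_le_ne_top ENNReal.ofReal_ne_top h1) h1 hx')

lemma measurableSet_innerApprox (n : ℕ) (r : ℝ) :
    MeasurableSet[cylinderAlgebra T A n] (innerApprox T A z n r) :=
  @MeasurableSet.sUnion _ (cylinderAlgebra T A n) _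
    ((countable_cylinders n).mono fun _ hC => hC.1)
    fun _ hC => MeasurableSpace.measurableSet_generateFrom hC.1

lemma measurableSet_outerApprox (n : ℕ) (r : ℝ) :
    MeasurableSet[cylinderAlgebra T A n] (outerApprox T A z n r) :=
  @MeasurableSet.sUnion _ (cylinderAlgebra T A n) _
    ((countable_cylinders n).mono fun _ hC => hC.1)
    fun _ hC => MeasurableSpace.measurableSet_generateFrom hC.1

lemma eventually_rball_subset {V : Set Ω} (hV : V ∈ 𝓝 z) : ∀ᶠ r in 𝓝[>] (0 : ℝ), rball z r ⊆ V := by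
  obtain ⟨ε, hε, h⟩ := EMetric.mem_nhds_iff.1 hV
  have h1 : Tendsto ENNReal.ofReal (𝓝[>] 0) (𝓝 0) := by
    simpa using (ENNReal.continuous_ofReal.tendsto 0).mono_left nhdsWithin_le_nhds
  filter_upwards [h1.eventually_lt_const hε] with r hr
  exact (Metric.eball_subset_eball hr.le).trans h

/-- If `T^j z ≠ z`, small balls around `z` do not return at time `j`. -/
lemma eventually_disjoint_rball (hT : Continuous T) {j : ℕ} (hj : T^[j] z ≠ z) :
    ∀ᶠ r in 𝓝[>] (0 : ℝ), ∀ x ∈ rball z r, T^[j] x ∉ rball z r := by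
  obtain ⟨u, w, hu, hw, hzu, hzw, huw⟩ := t2_separation hj
  have hV : T^[j] ⁻¹' u ∩ w ∈ 𝓝 z :=
    inter_mem ((hT.iterate j).continuousAt.preimage_mem_nhds (hu.mem_nhds hzu)) (hw.mem_nhds hzw)
  filter_upwards [eventually_rball_subset hV] with r hr x hx hx'
  exact disjoint_left.1 huw (hr hx).1 (hr hx').2

lemma eventually_inter_avoid_rball (hT : Continuous T) {J : ℕ}
    (hJ : ∀ j, 1 ≤ j → j ≤ J → T^[j] z ≠ z) :
    ∀ᶠ r in 𝓝[>] (0 : ℝ), rball z r ∩ avoid T (rball z r) J = rball z r := by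
  have h1 : ∀ᶠ r in 𝓝[>] (0 : ℝ), ∀ j ∈ Finset.Icc 1 J, ∀ x ∈ rball z r, T^[j] x ∉ rball z r :=
    (Filter.eventually_all_finset _).2 fun j hj =>
      eventually_disjoint_rball hT (hJ j (Finset.mem_Icc.1 hj).1 (Finset.mem_Icc.1 hj).2)
  filter_upwards [h1] with r hr
  exact inter_eq_left.2 fun x hx j h1 h2 => hr j (Finset.mem_Icc.2 ⟨h1, h2⟩) x hx

end Geometry

/-! ### Annuli of width comparable to r ^ v. -/

section Annulus

variable {F : ℝ → ℝ} {v : ℝ}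

lemma tendsto_rpow_nhdsGT_zero {a : ℝ} (ha : 0 < a) :
    Tendsto (fun r : ℝ => r ^ a) (𝓝[>] 0) (𝓝 0) := by
  have := (Real.continuousAt_rpow_const 0 a (Or.inr ha.le)).tendsto
  rw [Real.zero_rpow ha.ne'] at this
  exact this.mono_left nhdsWithin_le_nhds

lemma eventually_pos_of_tendsto_div (hF0 : ∀ r, 0 ≤ F r) {f : ℝ → ℝ}
    (h : Tendsto (fun r => F (f r) / F r) (𝓝[>] 0) (𝓝 1)) : ∀ᶠ r in 𝓝[>] 0, 0 < F r := by
  filter_upwards [h.eventually_const_lt one_pos] with r hr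
  refine (hF0 r).lt_of_ne fun h0 => ?_
  -- Division by 0 has value 0, so a ratio near 1 forces a positive denominator.
  rw [← h0, div_zero] at hr
  exact lt_irrefl _ hr

lemma tendsto_add_mul_rpow (hv : 0 < v) {C : ℝ} (hC : 0 ≤ C) :
    Tendsto (fun r : ℝ => r + C * r ^ v) (𝓝[>] 0) (𝓝[>] 0) := by
  refine tendsto_nhdsWithin_iff.2 ⟨?_, ?_⟩
  · have h : Tendsto (fun r : ℝ => r) (𝓝[>] 0) (𝓝 0) := nhdsWithin_le_nhds
    simpa using h.add ((tendsto_rpow_nhdsGT_zero hv).const_mul C)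
  · filter_upwards [self_mem_nhdsWithin] with r hr
    have hr : 0 < r := hr
    exact mem_Ioi.2 (by positivity)

/-- Iterate the hypothesis: at the larger radius r + K r^v the permitted increment is at least r^v,
so each step adds another r^v. -/
lemma tendsto_annulus_nat (hF : Monotone F) (hF0 : ∀ r, 0 ≤ F r) (hv : 0 < v)
    (h : Tendsto (fun r => F (r + r ^ v) / F r) (𝓝[>] 0) (𝓝 1)) (K : ℕ) :
    Tendsto (fun r => F (r + K * r ^ v) / F r) (𝓝[>] 0) (𝓝 1) := by
  have hpos := eventually_pos_of_tendsto_div hF0 h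
  induction K with
  | zero =>
    refine tendsto_const_nhds.congr' ?_
    filter_upwards [hpos] with r hr
    simp [hr.ne']
  | succ K ih =>
    have h1 := (h.comp (tendsto_add_mul_rpow hv (Nat.cast_nonneg K))).mul ih
    rw [one_mul] at h1
    refine tendsto_of_tendsto_of_tendsto_of_le_of_le' tendsto_const_nhds h1 ?_ ?_
    · filter_upwards [hpos, self_mem_nhdsWithin] with r hr hr0
      have hr0 : 0 < r := hr0
      rw [one_le_div hr]
      refine hF (le_add_of_nonneg_right ?_)
      positivity
    · filter_upwards [hpos, self_mem_nhdsWithin] with r hr hr0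
      have hr0 : 0 < r := hr0
      have h0 : (0 : ℝ) ≤ K * r ^ v := by positivity
      have h2 : 0 < F (r + K * r ^ v) := hr.trans_le (hF (by linarith))
      simp only [Function.comp_apply]
      rw [div_mul_div_cancel₀ h2.ne']
      gcongr
      refine hF ?_
      have : r ^ v ≤ (r + K * r ^ v) ^ v := by gcongr; linarith
      push_cast
      linarith

lemma tendsto_annulus (hF : Monotone F) (hF0 : ∀ r, 0 ≤ F r) (hv : 0 < v)
    (h : Tendsto (fun r => F (r + r ^ v) / F r) (𝓝[>] 0) (𝓝 1)) {C : ℝ} (hC : 0 ≤ C) :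
    Tendsto (fun r => F (r + C * r ^ v) / F r) (𝓝[>] 0) (𝓝 1) := by
  have hpos := eventually_pos_of_tendsto_div hF0 h
  refine tendsto_of_tendsto_of_tendsto_of_le_of_le' tendsto_const_nhds
    (tendsto_annulus_nat hF hF0 hv h ⌈C⌉₊) ?_ ?_
  · filter_upwards [hpos, self_mem_nhdsWithin] with r hr hr0
    have hr0 : 0 < r := hr0
    rw [one_le_div hr]
    exact hF (le_add_of_nonneg_right (by positivity))
  · filter_upwards [hpos, self_mem_nhdsWithin] with r hr hr0
    have hr0 : 0 < r := hr0
    gcongr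
    refine hF ?_
    gcongr
    exact Nat.le_ceil C

/-- Apply the outer statement at r' = r - C r^v. As v > 1, eventually r ≤ 2r', so r ≤ r' + C 2^v
r'^v. -/
lemma tendsto_inner_annulus (hF : Monotone F) (hF0 : ∀ r, 0 ≤ F r) (hv : 1 < v)
    (h : Tendsto (fun r => F (r + r ^ v) / F r) (𝓝[>] 0) (𝓝 1)) {C : ℝ} (hC : 0 ≤ C) :
    Tendsto (fun r => F (r - C * r ^ v) / F r) (𝓝[>] 0) (𝓝 1) := by
  have hv0 : 0 < v := by linarith
  have hpos := eventually_pos_of_tendsto_div hF0 h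
  have hhalf : ∀ᶠ r in 𝓝[>] (0 : ℝ), C * r ^ v ≤ r / 2 := by
    have := (tendsto_rpow_nhdsGT_zero (sub_pos.2 hv)).const_mul C
    rw [mul_zero] at this
    filter_upwards [this.eventually_lt_const (show (0 : ℝ) < 1 / 2 by norm_num),
      self_mem_nhdsWithin] with r hr hr0
    have hr0 : 0 < r := hr0
    rw [Real.rpow_sub_one hr0.ne', ← mul_div_assoc, div_lt_iff₀ hr0] at hr
    linarith
  have hto : Tendsto (fun r : ℝ => r - C * r ^ v) (𝓝[>] 0) (𝓝[>] 0) := by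
    refine tendsto_nhdsWithin_iff.2 ⟨?_, ?_⟩
    · have h : Tendsto (fun r : ℝ => r) (𝓝[>] 0) (𝓝 0) := nhdsWithin_le_nhds
      simpa using h.sub ((tendsto_rpow_nhdsGT_zero hv0).const_mul C)
    · filter_upwards [hhalf, self_mem_nhdsWithin] with r hr hr0
      have hr0 : 0 < r := hr0
      exact mem_Ioi.2 (by linarith)
  have hC' : 0 ≤ C * 2 ^ v := by positivity
  have h1 := ((tendsto_annulus hF hF0 hv0 h hC').comp hto).inv₀ one_ne_zero
  rw [inv_one] at h1
  refine tendsto_of_tendsto_of_tendsto_of_le_of_le' h1 tendsto_const_nhds ?_ ?_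
  · filter_upwards [hpos, hhalf, hto.eventually hpos, self_mem_nhdsWithin] with r hr hh hp hr0
    have hr0 : 0 < r := hr0
    simp only [Function.comp_apply, inv_div]
    gcongr
    refine hF ?_
    have h2 : r ^ v ≤ (2 * (r - C * r ^ v)) ^ v := by gcongr; linarith
    rw [Real.mul_rpow (by norm_num) (by linarith)] at h2
    nlinarith
  · filter_upwards [hpos, self_mem_nhdsWithin] with r hr hr0
    have hr0 : 0 < r := hr0
    rw [div_le_one hr]
    refine hF (sub_le_self _ ?_)
    positivity

end Annulus

/-! ### Standing assumptions and the choice of cylinder order. -/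

section Setup

/-- The standing assumptions on the system near the point `z`. -/
structure BallMixing {Ω : Type*} [EMetricSpace Ω] [MeasurableSpace Ω] (μ : Measure Ω) (T : Ω → Ω)
    (A : ℕ → Set Ω) (φ : ℕ → ℝ) (κ c v d : ℝ) (z : Ω) : Prop where
  preserving : MeasurePreserving T μ μ
  partition : IsMeasurablePartition A
  mixing : IsRightPhiMixing μ T A φ
  κ_pos : 0 < κ
  c_pos : 0 < c
  one_lt_v : 1 < v
  d_pos : 0 < d
  v_lt : v < κ * d
  diam : ∀ n : ℕ, 1 ≤ n → ∀ C ∈ cylinders T A n,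
    Metric.ediam C ≤ ENNReal.ofReal (c * (n : ℝ) ^ (-κ))
  annulus : Tendsto (fun r : ℝ => μ.real (rball z (r + r ^ v)) / μ.real (rball z r))
    (𝓝[>] 0) (𝓝 1)
  ball : (fun r : ℝ => μ.real (rball z r)) =O[𝓝[>] 0] fun r : ℝ => r ^ d

variable {Ω : Type*} [EMetricSpace Ω] [MeasurableSpace Ω] {μ : Measure Ω}
  {T : Ω → Ω} {A : ℕ → Set Ω} {φ : ℕ → ℝ} {κ c v d : ℝ} {z : Ω}

lemma monotone_rball [IsProbabilityMeasure μ] : Monotone fun r => μ.real (rball z r) :=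
  fun _ _ h => measureReal_mono (rball_mono h)

namespace BallMixing

variable (h : BallMixing μ T A φ κ c v d z)
include h

lemma eventually_pos : ∀ᶠ r in 𝓝[>] (0 : ℝ), 0 < μ.real (rball z r) :=
  eventually_pos_of_tendsto_div (F := fun r => μ.real (rball z r)) (fun _ => measureReal_nonneg)
    h.annulus

lemma tendsto_measureReal_rball : Tendsto (fun r => μ.real (rball z r)) (𝓝[>] 0) (𝓝[>] 0) := by
  refine tendsto_nhdsWithin_iff.2 ⟨?_, h.eventually_pos⟩
  exact h.ball.trans_tendsto (tendsto_rpow_nhdsGT_zero h.d_pos)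

lemma measurableSet_of_cylinderAlgebra {n : ℕ} {U : Set Ω}
    (hU : MeasurableSet[cylinderAlgebra T A n] U) : MeasurableSet U :=
  cylinderAlgebra_le_measurable h.preserving.measurable h.partition.measurableSet _ _ hU

lemma φ_nonneg (k : ℕ) : 0 ≤ φ k := h.mixing.antitone.le_of_tendsto h.mixing.tendsto_zero k

lemma outerApprox_subset_rball {n : ℕ} {r : ℝ} (hr : 0 < r)
    (hn : 1 ≤ n ∧ (n : ℝ) ^ (-κ) ≤ r ^ v) :
    outerApprox T A z n r ⊆ rball z (r + c * r ^ v) := by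
  have h3 := h.c_pos
  refine (outerApprox_subset hr.le (by positivity) (h.diam _ hn.1)).trans (rball_mono ?_)
  gcongr
  exact hn.2

variable [IsProbabilityMeasure μ]

lemma tendsto_innerApprox {N : ℝ → ℕ}
    (hN : ∀ r : ℝ, 0 < r → 1 ≤ N r ∧ (N r : ℝ) ^ (-κ) ≤ r ^ v) :
    Tendsto (fun r => μ.real (innerApprox T A z (N r) r) / μ.real (rball z r)) (𝓝[>] 0)
      (𝓝 1) := by
  refine tendsto_of_tendsto_of_tendsto_of_le_of_le'
    (tendsto_inner_annulus (F := fun r => μ.real (rball z r)) monotone_rball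
      (fun _ => measureReal_nonneg) h.one_lt_v h.annulus h.c_pos.le) tendsto_const_nhds ?_ ?_
  · filter_upwards [self_mem_nhdsWithin] with r hr
    obtain ⟨h1, h2⟩ := hN r hr
    have h3 := h.c_pos
    refine div_le_div_of_nonneg_right (measureReal_mono ((rball_mono ?_).trans
      (subset_innerApprox h.partition.iUnion_eq (by positivity) (h.diam _ h1)))) measureReal_nonneg
    gcongr
  · filter_upwards [h.eventually_pos] with r hr
    rw [div_le_one hr]
    exact measureReal_mono (innerApprox_subset _ _)

lemma tendsto_outerApprox {N : ℝ → ℕ}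
    (hN : ∀ r : ℝ, 0 < r → 1 ≤ N r ∧ (N r : ℝ) ^ (-κ) ≤ r ^ v) :
    Tendsto (fun r => μ.real (outerApprox T A z (N r) r) / μ.real (rball z r)) (𝓝[>] 0)
      (𝓝 1) := by
  refine tendsto_of_tendsto_of_tendsto_of_le_of_le' tendsto_const_nhds
    (tendsto_annulus (F := fun r => μ.real (rball z r)) monotone_rball
      (fun _ => measureReal_nonneg) (zero_lt_one.trans h.one_lt_v) h.annulus h.c_pos.le) ?_ ?_
  · filter_upwards [h.eventually_pos] with r hr
    rw [one_le_div hr]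
    exact measureReal_mono (subset_outerApprox h.partition.iUnion_eq _ _)
  · filter_upwards [self_mem_nhdsWithin] with r hr
    exact div_le_div_of_nonneg_right (measureReal_mono
      (h.outerApprox_subset_rball hr (hN r hr))) measureReal_nonneg

/-- Away from 0 the bound is free because μ ≤ 1. Uniformity in r matters: it is applied at radii
enlarged by cylinder diameters, which do not shrink with r. -/
lemma exists_ball_bound : ∃ C : ℝ, 0 ≤ C ∧ ∀ r, 0 < r → μ.real (rball z r) ≤ C * r ^ d := by
  obtain ⟨C, hC, hb⟩ := h.ball.exists_pos
  rw [Asymptotics.isBigOWith_iff, eventually_nhdsWithin_iff, Metric.eventually_nhds_iff] at hb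
  obtain ⟨ρ, hρ, hb⟩ := hb
  have hρd : 0 < ρ ^ d := by positivity
  refine ⟨max C (ρ ^ d)⁻¹, by positivity, fun r hr => ?_⟩
  have hrd : 0 < r ^ d := by positivity
  rcases lt_or_ge r ρ with hlt | hge
  · have := hb (y := r) (by rwa [Real.dist_eq, sub_zero, abs_of_pos hr]) hr
    rw [Real.norm_of_nonneg measureReal_nonneg, Real.norm_of_nonneg hrd.le] at this
    exact this.trans (by gcongr; exact le_max_left _ _)
  · calc μ.real (rball z r) ≤ 1 := measureReal_le_one
      _ ≤ (ρ ^ d)⁻¹ * r ^ d := by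
        rw [inv_mul_eq_div, one_le_div hρd]
        exact Real.rpow_le_rpow hρ.le hge h.d_pos.le
      _ ≤ _ := by gcongr; exact le_max_right _ _

end BallMixing

/-- The order of the cylinders that resolve the ball of radius `r` to the scale `r ^ v`. -/
def order (κ v : ℝ) (r : ℝ) : ℕ := ⌈r ^ (-v / κ)⌉₊

lemma order_spec {κ v : ℝ} (hκ : 0 < κ) {r : ℝ} (hr : 0 < r) :
    1 ≤ order κ v r ∧ (order κ v r : ℝ) ^ (-κ) ≤ r ^ v := by
  have h1 : 0 < r ^ (-v / κ) := by positivity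
  refine ⟨Nat.one_le_iff_ne_zero.2 (Nat.ceil_pos.2 h1).ne', ?_⟩
  have h2 := Real.rpow_le_rpow_of_nonpos h1 (Nat.le_ceil (r ^ (-v / κ))) (neg_nonpos.2 hκ.le)
  rw [← Real.rpow_mul hr.le] at h2
  rwa [show -v / κ * -κ = v by field_simp] at h2

/-- The order is at most r^(-v/κ) + 1 and d - v/κ > 0. So the memory of the approximating sets is
short compared with their return time scale. -/
lemma tendsto_order_mul_rpow {κ v d : ℝ} (hκ : 0 < κ) (hd : 0 < d) (hv : v < κ * d) :
    Tendsto (fun r : ℝ => order κ v r * r ^ d) (𝓝[>] 0) (𝓝 0) := by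
  have h1 : 0 < d + -v / κ := by
    rw [neg_div, ← sub_eq_add_neg, sub_pos, div_lt_iff₀ hκ]; linarith
  have h2 := (tendsto_rpow_nhdsGT_zero h1).add (tendsto_rpow_nhdsGT_zero hd)
  rw [add_zero] at h2
  refine tendsto_of_tendsto_of_tendsto_of_le_of_le' tendsto_const_nhds h2 ?_ ?_
  · filter_upwards [self_mem_nhdsWithin] with r hr
    have hr : 0 < r := hr
    positivity
  · filter_upwards [self_mem_nhdsWithin] with r hr
    have hr : 0 < r := hr
    rw [Real.rpow_add hr, mul_comm (r ^ d), ← add_one_mul]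
    gcongr
    exact (Nat.ceil_lt_add_one (by positivity)).le

end Setup

/-! ### First-order expansion and stability of the extremal index. -/

section FirstOrder

variable {Ω : Type*} [MeasurableSpace Ω] {μ : Measure Ω} [IsProbabilityMeasure μ] {T : Ω → Ω}

/-- Expand 1 - g(t) as ∑ a_i. For i ≥ J, a_i lies below a_J by at most the clustering bound `hcl`,
and `hq` places a_J near LM. -/
lemma hasFirstOrder_avoid (hμ : MeasurePreserving T μ μ) {l : Filter ℝ} {U : ℝ → Set Ω} {L : ℝ}
    (hU : ∀ᶠ r in l, MeasurableSet (U r)) (hpos : ∀ᶠ r in l, 0 < μ.real (U r))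
    (hcl : ∀ δ > 0, ∀ᶠ J in atTop, ∀ᶠ r in l, ∀ e : ℕ,
      μ.real (U r ∩ avoid T (U r) J) - μ.real (U r ∩ avoid T (U r) (J + e)) ≤
        (δ + e * μ.real (U r)) * μ.real (U r))
    (hq : ∀ᶠ J in atTop,
      Tendsto (fun r => μ.real (U r ∩ avoid T (U r) J) / μ.real (U r)) l (𝓝 L)) :
    HasFirstOrder l (fun r t => μ.real (avoid T (U r) t)) (fun r => μ.real (U r)) L := by
  intro δ hδ
  obtain ⟨J, hJ, hJq⟩ := ((hcl (δ / 2) (by positivity)).and hq).exists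
  -- Each of the first J terms is within (1 + |L|)M of LM.
  refine ⟨J * (1 + |L|), ?_⟩
  have hq' := Metric.tendsto_nhds.1 hJq (δ / 2) (by positivity)
  filter_upwards [hU, hpos, hJ, hq'] with r hU hpos hJ hq' t
  set M := μ.real (U r)
  set a : ℕ → ℝ := fun i => μ.real (U r ∩ avoid T (U r) i) with ha
  have haJ : |a J - L * M| ≤ δ / 2 * M := by
    rw [Real.dist_eq, div_sub' hpos.ne', abs_div, abs_of_pos hpos, div_lt_iff₀ hpos,
      mul_comm M L] at hq'
    exact hq'.le
  have ha0 : ∀ i, 0 ≤ a i := fun i => measureReal_nonneg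
  have haM : ∀ i, a i ≤ M := fun i => measureReal_mono inter_subset_left
  have hanti : Antitone a := fun i j hij =>
    measureReal_mono (inter_subset_inter_right _ (avoid_anti hij))
  have hterm : ∀ i ∈ Finset.range t, |a i - L * M| ≤
      (if i < J then (1 + |L|) * M else 0) + (δ + t * M) * M := by
    intro i hi
    have hit : (i : ℝ) ≤ t := by exact_mod_cast (Finset.mem_range.1 hi).le
    have h0 : 0 ≤ (δ + t * M) * M := by positivity
    split_ifs with hiJ
    · have h1 : |a i - L * M| ≤ |a i| + |L * M| := abs_sub _ _
      rw [abs_of_nonneg (ha0 i), abs_mul, abs_of_pos hpos] at h1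
      have := haM i
      linarith
    · have h1 := hJ (i - J)
      have h2 : a i ≤ a J := hanti (not_lt.1 hiJ)
      rw [show J + (i - J) = i by omega] at h1
      have h3 : ((i - J : ℕ) : ℝ) ≤ t := le_trans (by exact_mod_cast Nat.sub_le i J) hit
      have h4 : a J - a i ≤ (δ / 2 + t * M) * M := h1.trans (by gcongr)
      have h5 := abs_le.1 haJ
      have h6 : 0 ≤ t * M * M := by positivity
      have h7 : 0 ≤ δ / 2 * M := by positivity
      rw [zero_add, abs_le]
      constructor <;> linarith
  have hsum : 1 - μ.real (avoid T (U r) t) - L * (t * M) =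
      ∑ i ∈ Finset.range t, (a i - L * M) := by
    rw [one_sub_measureReal_avoid hμ hU, Finset.sum_sub_distrib]
    simp only [ha, Finset.sum_const, Finset.card_range, nsmul_eq_mul]
    ring
  rw [hsum]
  refine (Finset.abs_sum_le_sum_abs _ _).trans ((Finset.sum_le_sum hterm).trans ?_)
  rw [Finset.sum_add_distrib, ← Finset.sum_filter, Finset.sum_const, Finset.sum_const,
    Finset.card_range, nsmul_eq_mul, nsmul_eq_mul]
  have hcard : (((Finset.range t).filter (· < J)).card : ℝ) ≤ J := by
    have : (Finset.range t).filter (· < J) ⊆ Finset.range J := fun i hi =>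
      Finset.mem_range.2 (Finset.mem_filter.1 hi).2
    exact_mod_cast (Finset.card_le_card this).trans (Finset.card_range J).le
  have h0 : 0 ≤ (1 + |L|) * M := by positivity
  have := mul_le_mul_of_nonneg_right hcard h0
  linarith

/-- The extremal index passes from a family of sets to a family that is equal to it to first
order. -/
lemma tendsto_inter_avoid_of_nested (hμ : MeasurePreserving T μ μ) {l : Filter ℝ}
    {U B : ℝ → Set Ω} {L : ℝ} (hU : ∀ᶠ r in l, MeasurableSet (U r))
    (hB : ∀ᶠ r in l, MeasurableSet (B r)) (hBpos : ∀ᶠ r in l, 0 < μ.real (B r))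
    (hnest : ∀ᶠ r in l, U r ⊆ B r ∨ B r ⊆ U r)
    (hratio : Tendsto (fun r => μ.real (U r) / μ.real (B r)) l (𝓝 1)) {J : ℕ}
    (hq : Tendsto (fun r => μ.real (B r ∩ avoid T (B r) J) / μ.real (B r)) l (𝓝 L)) :
    Tendsto (fun r => μ.real (U r ∩ avoid T (U r) J) / μ.real (U r)) l (𝓝 L) := by
  have herr : Tendsto (fun r => (J + 1) * |1 - μ.real (U r) / μ.real (B r)|) l (𝓝 0) := by
    simpa using ((hratio.const_sub 1).abs).const_mul ((J : ℝ) + 1)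
  have hdiff : Tendsto (fun r => (μ.real (U r ∩ avoid T (U r) J) -
      μ.real (B r ∩ avoid T (B r) J)) / μ.real (B r)) l (𝓝 0) := by
    refine squeeze_zero_norm' ?_ herr
    filter_upwards [hU, hB, hBpos, hnest] with r hU hB hpos hnest
    rw [Real.norm_eq_abs, abs_div, abs_of_pos hpos, div_le_iff₀ hpos, one_sub_div hpos.ne', abs_div,
      abs_of_pos hpos, mul_assoc, div_mul_cancel₀ _ hpos.ne']
    rcases hnest with h | h
    · refine (abs_measureReal_inter_avoid_sub_le hμ hU hB h J).trans ?_
      gcongr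
      exact le_abs_self _
    · rw [abs_sub_comm]
      refine (abs_measureReal_inter_avoid_sub_le hμ hB hU h J).trans ?_
      gcongr
      rw [abs_sub_comm]
      exact le_abs_self _
  have h1 := (hq.add hdiff).div hratio one_ne_zero
  rw [add_zero, div_one] at h1
  refine h1.congr' ?_
  filter_upwards [hBpos] with r hpos
  simp only [Pi.div_apply]
  rw [← add_div, add_sub_cancel, div_div_div_cancel_right₀ hpos.ne']

/-- Under the condition on nested returns, a return of `U ⊆ B` at a multiple of `p` without a return
of `B` at time `p` is negligible. -/
lemma measureReal_return_diff_le (hμ : MeasurePreserving T μ μ) {U B : Set Ω}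
    (hU : MeasurableSet U) (hB : MeasurableSet B) (hUB : U ⊆ B) {p u : ℕ} (hu : 1 ≤ u) {e : ℝ}
    (he : |μ.real (U ∩ T^[p * u] ⁻¹' U) - μ.real (iterInter T p U u)| ≤
      e * μ.real (iterInter T p U u)) :
    μ.real ((B ∩ T^[p * u] ⁻¹' B) \ T^[p] ⁻¹' B) ≤
      2 * (μ.real B - μ.real U) + |e| * μ.real B := by
  -- As u ≥ 1, the nested intersection forces a return at p. The exceptions either lie in the part
  -- controlled by `he` or meet B \ U at time 0 or pu, whence the factor 2.
  have hsub : (B ∩ T^[p * u] ⁻¹' B) \ T^[p] ⁻¹' B ⊆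
      ((U ∩ T^[p * u] ⁻¹' U) \ iterInter T p U u) ∪ ((B \ U) ∪ T^[p * u] ⁻¹' (B \ U)) := by
    rintro x ⟨⟨h1, h2⟩, h3⟩
    by_cases h4 : x ∈ U
    · by_cases h5 : T^[p * u] x ∈ U
      · refine Or.inl ⟨⟨h4, h5⟩, fun h6 => h3 (hUB ?_)⟩
        simpa using mem_iInter₂.1 h6 1 (Finset.mem_range.2 (by omega))
      · exact Or.inr (Or.inr ⟨h2, h5⟩)
    · exact Or.inr (Or.inl ⟨h1, h4⟩)
  have hiter : iterInter T p U u ⊆ U ∩ T^[p * u] ⁻¹' U := fun x hx =>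
    ⟨by simpa using mem_iInter₂.1 hx 0 (Finset.mem_range.2 (by omega)),
      mem_iInter₂.1 hx u (Finset.mem_range.2 (by omega))⟩
  have hm : MeasurableSet (iterInter T p U u) :=
    Finset.measurableSet_biInter _ fun j _ => hμ.measurable.iterate _ hU
  have h1 : μ.real ((U ∩ T^[p * u] ⁻¹' U) \ iterInter T p U u) =
      μ.real (U ∩ T^[p * u] ⁻¹' U) - μ.real (iterInter T p U u) := measureReal_sdiff hiter hm
  have h2 : μ.real (B \ U) = μ.real B - μ.real U := measureReal_sdiff hUB hU
  have h3 : μ.real (T^[p * u] ⁻¹' (B \ U)) = μ.real (B \ U) :=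
    measureReal_preimage_iterate hμ (hB.diff hU) _
  have h4 : e * μ.real (iterInter T p U u) ≤ |e| * μ.real B := by
    refine mul_le_mul (le_abs_self e) ?_ measureReal_nonneg (abs_nonneg e)
    exact measureReal_mono (hiter.trans (inter_subset_left.trans hUB))
  have h5 := (measureReal_mono (μ := μ) hsub).trans (measureReal_union_le _ _)
  have h6 := measureReal_union_le (μ := μ) (B \ U) (T^[p * u] ⁻¹' (B \ U))
  have h7 := le_abs_self (μ.real (U ∩ T^[p * u] ⁻¹' U) - μ.real (iterInter T p U u))
  linarith

end FirstOrder

/-! ### Late returns are rare; rates for cylinder sets. -/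

section Cluster

lemma sum_ite_add_lt_le {X : ℝ} (hX : 0 ≤ X) (a b e : ℕ) :
    ∑ h ∈ Finset.range e, (if a + h < b then X else 0) ≤ b * X := by
  rw [← Finset.sum_filter, Finset.sum_const, nsmul_eq_mul]
  gcongr
  have : (Finset.range e).filter (fun h => a + h < b) ⊆ Finset.range b := fun i hi =>
    Finset.mem_range.2 (by have := (Finset.mem_filter.1 hi).2; omega)
  exact (Finset.card_le_card this).trans (Finset.card_range b).le

lemma add_rpow_le_two_mul {a b d : ℝ} (ha : 0 ≤ a) (hb : 0 ≤ b) (hd : 0 ≤ d) :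
    (a + b) ^ d ≤ (2 * a) ^ d + (2 * b) ^ d := by
  rcases le_total a b with h | h
  · have h1 : (a + b) ^ d ≤ (2 * b) ^ d := by gcongr; linarith
    have h2 : 0 ≤ (2 * a) ^ d := by positivity
    linarith
  · have h1 : (a + b) ^ d ≤ (2 * a) ^ d := by gcongr; linarith
    have h2 : 0 ≤ (2 * b) ^ d := by positivity
    linarith

variable {Ω : Type*} [EMetricSpace Ω] [MeasurableSpace Ω] {μ : Measure Ω}
  [IsProbabilityMeasure μ] {T : Ω → Ω} {A : ℕ → Set Ω} {φ : ℕ → ℝ} {κ c v d : ℝ} {z : Ω}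

namespace BallMixing

variable (h : BallMixing μ T A φ κ c v d z)
include h

/-- A (j / 2)-cylinder has diameter at most a constant times j^(-κ). The j-dependent term is
summable because κd > 1; the other occurs at most 2 `order` times in the clustering bound and then
vanishes with r. -/
lemma exists_outerApprox_bound : ∃ C C' : ℝ, 0 ≤ C ∧ 0 ≤ C' ∧ ∀ r, 0 < r → ∀ j : ℕ, 2 ≤ j →
    μ.real (outerApprox T A z (j / 2) r) ≤ C * r ^ d + C' * (j : ℝ) ^ (-(κ * d)) := by
  obtain ⟨C, hC, hb⟩ := h.exists_ball_bound
  have hc := h.c_pos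
  have hd := h.d_pos
  refine ⟨C * 2 ^ d, C * (2 * (c * 4 ^ κ)) ^ d, by positivity, by positivity, fun r hr j hj => ?_⟩
  have hj0 : (0 : ℝ) < j := by positivity
  have h1 : ((j / 2 : ℕ) : ℝ) ^ (-κ) ≤ 4 ^ κ * (j : ℝ) ^ (-κ) := by
    have h2 : (j : ℝ) / 4 ≤ ((j / 2 : ℕ) : ℝ) := by
      rw [div_le_iff₀ (by norm_num)]
      have : j ≤ j / 2 * 4 := by omega
      exact_mod_cast this
    have h3 := Real.rpow_le_rpow_of_nonpos (by positivity) h2 (neg_nonpos.2 h.κ_pos.le)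
    refine h3.trans_eq ?_
    rw [Real.div_rpow hj0.le (by norm_num), Real.rpow_neg (by norm_num : (0 : ℝ) ≤ 4), div_inv_eq_mul,
      mul_comm]
  calc μ.real (outerApprox T A z (j / 2) r)
      ≤ μ.real (rball z (r + c * 4 ^ κ * (j : ℝ) ^ (-κ))) := by
        refine measureReal_mono ((outerApprox_subset hr.le (by positivity)
          (h.diam _ (by omega))).trans (rball_mono ?_))
        rw [mul_assoc]
        gcongr
    _ ≤ C * (r + c * 4 ^ κ * (j : ℝ) ^ (-κ)) ^ d := hb _ (by positivity)
    _ ≤ C * ((2 * r) ^ d + (2 * (c * 4 ^ κ * (j : ℝ) ^ (-κ))) ^ d) := by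
        gcongr
        exact add_rpow_le_two_mul hr.le (by positivity) hd.le
    _ = _ := by
        rw [Real.mul_rpow (by norm_num) hr.le, ← mul_assoc 2 (c * 4 ^ κ),
          Real.mul_rpow (x := 2 * (c * 4 ^ κ)) (by positivity) (by positivity),
          ← Real.rpow_mul hj0.le, neg_mul]
        ring

lemma eventually_cluster_le {U : ℝ → Set Ω} {K : ℝ} (hK : 0 < K)
    (hU : ∀ r, MeasurableSet[cylinderAlgebra T A (order κ v r)] (U r))
    (hUK : ∀ᶠ r in 𝓝[>] (0 : ℝ), U r ⊆ rball z (K * r)) {δ : ℝ} (hδ : 0 < δ) :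
    ∀ᶠ J in atTop, ∀ᶠ r in 𝓝[>] (0 : ℝ), ∀ e : ℕ,
      μ.real (U r ∩ avoid T (U r) J) - μ.real (U r ∩ avoid T (U r) (J + e)) ≤
        (δ + e * μ.real (U r)) * μ.real (U r) := by
  obtain ⟨C, C', hC, hC', hb⟩ := h.exists_outerApprox_bound
  set u : ℕ → ℝ := fun j => C' * (j : ℝ) ^ (-(κ * d)) with hu
  have hsu : Summable u :=
    (Real.summable_nat_rpow.2 (by linarith [h.one_lt_v, h.v_lt])).mul_left C'
  have hu0 : ∀ j, 0 ≤ u j := fun j => by positivity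
  have htail : Tendsto (fun J => ∑' i, u (i + (J + 1))) atTop (𝓝 0) :=
    (tendsto_sum_nat_add u).comp (tendsto_add_atTop_nat 1)
  have hφJ : Tendsto (fun J => φ (J / 2)) atTop (𝓝 0) :=
    h.mixing.tendsto_zero.comp (Nat.tendsto_div_const_atTop two_ne_zero)
  filter_upwards [htail.eventually_lt_const (show 0 < δ / 3 by positivity),
    hφJ.eventually_lt_const (show 0 < δ / 3 by positivity), eventually_ge_atTop 1] with J h1 h2 hJ
  have hnr : Tendsto (fun r : ℝ => 2 * (C * K ^ d) * (order κ v r * r ^ d)) (𝓝[>] 0) (𝓝 0) := by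
    simpa using (tendsto_order_mul_rpow h.κ_pos h.d_pos h.v_lt).const_mul (2 * (C * K ^ d))
  filter_upwards [hUK, hnr.eventually_lt_const (show 0 < δ / 3 by positivity),
    self_mem_nhdsWithin] with r hUK h3 hr e
  have hr : 0 < r := hr
  have hKr : 0 < K * r := by positivity
  -- The coarse neighbourhood is used only until j / 2 coordinates resolve U itself; from then on
  -- each j costs μ(U), which gives e * μ(U).
  set V : ℕ → Set Ω := fun j =>
    if j / 2 < order κ v r then outerApprox T A z (j / 2) (K * r) else U r with hV
  have hVm : ∀ j, MeasurableSet[cylinderAlgebra T A (j / 2)] (V j) := by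
    intro j
    simp only [hV]
    split_ifs with hj
    · exact measurableSet_outerApprox _ _
    · exact cylinderAlgebra_mono h.partition.iUnion_eq (not_lt.1 hj) _ (hU r)
  have hUV : ∀ j, U r ⊆ V j := by
    intro j
    simp only [hV]
    split_ifs with hj
    · exact hUK.trans (subset_outerApprox h.partition.iUnion_eq _ _)
    · exact Subset.rfl
  refine (measureReal_inter_avoid_sub_le h.preserving h.partition h.mixing (hU r) V
    (fun j _ => hVm j) (fun j _ => hUV j) e).trans ?_
  refine mul_le_mul_of_nonneg_right ?_ measureReal_nonneg
  have hterm : ∀ i ∈ Finset.range e, μ.real (V (J + 1 + i)) ≤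
      (if J + 1 + i < 2 * order κ v r then C * (K * r) ^ d else 0) + u (i + (J + 1)) +
        μ.real (U r) := by
    intro i _
    have hU0 := measureReal_nonneg (μ := μ) (s := U r)
    rw [add_comm i]
    by_cases hj : (J + 1 + i) / 2 < order κ v r
    · have := hb (K * r) hKr (J + 1 + i) (by omega)
      simp only [hV, if_pos hj, hu]
      rw [if_pos (by omega)]
      linarith
    · simp only [hV, if_neg hj]
      have h4 : (0 : ℝ) ≤ if J + 1 + i < 2 * order κ v r then C * (K * r) ^ d else 0 := by
        split_ifs <;> positivity
      linarith [hu0 (J + 1 + i)]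
  have hsum := Finset.sum_le_sum hterm
  rw [Finset.sum_add_distrib, Finset.sum_add_distrib, Finset.sum_const, Finset.card_range,
    nsmul_eq_mul] at hsum
  have h4 := sum_ite_add_lt_le (X := C * (K * r) ^ d) (by positivity) (J + 1)
    (2 * order κ v r) e
  have h5 : ∑ i ∈ Finset.range e, u (i + (J + 1)) ≤ ∑' i, u (i + (J + 1)) :=
    ((summable_nat_add_iff (J + 1)).2 hsu).sum_le_tsum _ fun i _ => hu0 _
  rw [Real.mul_rpow hK.le hr.le] at h4 hsum
  push_cast at h4
  linarith

/-- The exponential rate for a family `U r ∈ σ(𝒜^{n(r)})` that is comparable to the balls. -/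
lemma tendsto_rate {U : ℝ → Set Ω} {K L : ℝ} (hK : 0 < K) (hL : 0 < L)
    (hU : ∀ r, MeasurableSet[cylinderAlgebra T A (order κ v r)] (U r))
    (hUK : ∀ᶠ r in 𝓝[>] (0 : ℝ), U r ⊆ rball z (K * r))
    (hpos : ∀ᶠ r in 𝓝[>] (0 : ℝ), 0 < μ.real (U r))
    (hq : ∀ᶠ J in atTop,
      Tendsto (fun r => μ.real (U r ∩ avoid T (U r) J) / μ.real (U r)) (𝓝[>] 0) (𝓝 L))
    {t : ℝ → ℕ} (ht : Tendsto t (𝓝[>] 0) atTop)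
    (htM : Tendsto (fun r => t r * μ.real (U r)) (𝓝[>] 0) (𝓝 0) ∨
      ∃ s > 0, ∀ᶠ r in 𝓝[>] (0 : ℝ), s ≤ t r * μ.real (U r)) :
    (∀ᶠ r in 𝓝[>] (0 : ℝ), 0 < μ.real (avoid T (U r) (t r))) ∧
      Tendsto (fun r => -Real.log (μ.real (avoid T (U r) (t r))) / (t r * μ.real (U r)))
        (𝓝[>] 0) (𝓝 L) := by
  have hB : HasFirstOrder (𝓝[>] 0) (fun r t => μ.real (avoid T (U r) t))
      (fun r => μ.real (U r)) L :=
    hasFirstOrder_avoid h.preserving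
      (Eventually.of_forall fun r => h.measurableSet_of_cylinderAlgebra (hU r)) hpos
      (fun δ hδ => h.eventually_cluster_le hK hU hUK hδ) hq
  rcases htM with htM | ⟨s, hs, htM⟩
  · exact tendsto_neg_log_div_of_tendsto_zero hpos hB ht htM
  obtain ⟨C, hC, hb⟩ := h.exists_ball_bound
  have hd := h.d_pos
  have hbd : ∀ᶠ r in 𝓝[>] (0 : ℝ), μ.real (U r) ≤ C * K ^ d * r ^ d := by
    filter_upwards [hUK, self_mem_nhdsWithin] with r hr hr0
    have hr0 : 0 < r := hr0
    refine (measureReal_mono hr).trans ((hb _ (by positivity)).trans_eq ?_)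
    rw [Real.mul_rpow hK.le hr0.le, mul_assoc]
  have hM0 : Tendsto (fun r => μ.real (U r)) (𝓝[>] 0) (𝓝 0) := by
    have h1 := (tendsto_rpow_nhdsGT_zero hd).const_mul (C * K ^ d)
    rw [mul_zero] at h1
    exact tendsto_of_tendsto_of_tendsto_of_le_of_le' tendsto_const_nhds h1
      (Eventually.of_forall fun r => measureReal_nonneg) hbd
  have hnM : Tendsto (fun r => order κ v r * μ.real (U r)) (𝓝[>] 0) (𝓝 0) := by
    have h1 := (tendsto_order_mul_rpow h.κ_pos hd h.v_lt).const_mul (C * K ^ d)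
    rw [mul_zero] at h1
    refine tendsto_of_tendsto_of_tendsto_of_le_of_le' tendsto_const_nhds h1
      (Eventually.of_forall fun r => by positivity) ?_
    filter_upwards [hbd] with r hr
    rw [mul_left_comm]
    gcongr
  exact tendsto_neg_log_div_of_le hpos hM0 hnM h.mixing.tendsto_zero h.φ_nonneg
    (Eventually.of_forall fun r => isBlockSeq_avoid h.preserving h.partition h.mixing (hU r)) hL
    hB hs htM

end BallMixing

end Cluster

/-! ### Recurrence rates along balls and the extremal index at periodic points. -/

section Recurrence

variable {Ω : Type*} [EMetricSpace Ω] [MeasurableSpace Ω] {μ : Measure Ω} {T : Ω → Ω}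
  {A : ℕ → Set Ω} {φ : ℕ → ℝ} {κ c v d : ℝ} {z : Ω}

lemma measurableSet_rball [OpensMeasurableSpace Ω] (r : ℝ) : MeasurableSet (rball z r) :=
  Metric.isOpen_eball.measurableSet

variable [IsProbabilityMeasure μ]

namespace BallMixing

variable (h : BallMixing μ T A φ κ c v d z)
include h

variable [OpensMeasurableSpace Ω]

lemma tendsto_rate_of_nested {U : ℝ → Set Ω} {K L α s : ℝ} (hK : 0 < K) (hL : 0 < L) (hα : 0 < α)
    (hs : 0 < s) (hU : ∀ r, MeasurableSet[cylinderAlgebra T A (order κ v r)] (U r))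
    (hUK : ∀ᶠ r in 𝓝[>] (0 : ℝ), U r ⊆ rball z (K * r))
    (hnest : ∀ᶠ r in 𝓝[>] (0 : ℝ), U r ⊆ rball z r ∨ rball z r ⊆ U r)
    (hratio : Tendsto (fun r => μ.real (U r) / μ.real (rball z r)) (𝓝[>] 0) (𝓝 1))
    (hq : ∀ᶠ J in atTop, Tendsto
      (fun r => μ.real (rball z r ∩ avoid T (rball z r) J) / μ.real (rball z r)) (𝓝[>] 0) (𝓝 L)) :
    (∀ᶠ r in 𝓝[>] (0 : ℝ),
        0 < μ.real (avoid T (U r) ⌊s * μ.real (rball z r) ^ (-α)⌋₊)) ∧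
      Tendsto (fun r => -Real.log (μ.real (avoid T (U r) ⌊s * μ.real (rball z r) ^ (-α)⌋₊)) /
        (s * μ.real (rball z r) ^ (1 - α))) (𝓝[>] 0) (𝓝 L) := by
  set F : ℝ → ℝ := fun r => μ.real (rball z r) with hF
  set x : ℝ → ℝ := fun r => s * F r ^ (-α) with hx
  set t : ℝ → ℕ := fun r => ⌊x r⌋₊ with ht
  have hpos := h.eventually_pos
  have hF0 := h.tendsto_measureReal_rball
  have hUpos : ∀ᶠ r in 𝓝[>] (0 : ℝ), 0 < μ.real (U r) := by
    filter_upwards [hratio.eventually_const_lt one_pos, hpos] with r h1 h2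
    exact (div_pos_iff_of_pos_right h2).1 h1
  have hxtop : Tendsto x (𝓝[>] 0) atTop := by
    have h1 : Tendsto (fun y : ℝ => y ^ α) (𝓝[>] 0) (𝓝[>] 0) :=
      tendsto_nhdsWithin_iff.2 ⟨tendsto_rpow_nhdsGT_zero hα,
        eventually_mem_nhdsWithin.mono fun y hy => Real.rpow_pos_of_pos hy α⟩
    have h2 := ((h1.comp hF0).inv_tendsto_nhdsGT_zero).const_mul_atTop hs
    refine h2.congr fun r => ?_
    simp [hx, hF, Real.rpow_neg measureReal_nonneg]
  have httop : Tendsto t (𝓝[>] 0) atTop := tendsto_nat_floor_atTop.comp hxtop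
  have hxF : ∀ᶠ r in 𝓝[>] (0 : ℝ), x r * F r = s * F r ^ (1 - α) := by
    filter_upwards [hpos] with r hr
    rw [sub_eq_add_neg, add_comm, Real.rpow_add_one (ne_of_gt hr), mul_assoc]
  have hone : Tendsto (fun r => (t r : ℝ) / x r * (μ.real (U r) / F r)) (𝓝[>] 0) (𝓝 1) := by
    simpa using (tendsto_nat_floor_div_atTop.comp hxtop).mul hratio
  have hprod : ∀ᶠ r in 𝓝[>] (0 : ℝ), (t r : ℝ) / x r * (μ.real (U r) / F r) *
      (s * F r ^ (1 - α)) = t r * μ.real (U r) := by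
    filter_upwards [hpos, hxF, hxtop.eventually_gt_atTop 0] with r hr h1 h2
    have hr' : F r ≠ 0 := ne_of_gt hr
    rw [← h1]
    field_simp
  -- The product is asymptotic to s μ(B)^(1-α): it tends to 0 for α < 1 and is eventually at least
  -- s/2 for α ≥ 1.
  have hdich : Tendsto (fun r => t r * μ.real (U r)) (𝓝[>] 0) (𝓝 0) ∨
      ∃ s' > 0, ∀ᶠ r in 𝓝[>] (0 : ℝ), s' ≤ t r * μ.real (U r) := by
    rcases lt_or_ge α 1 with h1 | h1
    · left
      have h2 := hone.mul (((tendsto_rpow_nhdsGT_zero (sub_pos.2 h1)).comp hF0).const_mul s)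
      rw [mul_zero, mul_zero] at h2
      exact h2.congr' hprod
    · right
      refine ⟨1 / 2 * s, by positivity, ?_⟩
      filter_upwards [hprod, hone.eventually_const_lt (show (1 / 2 : ℝ) < 1 by norm_num), hpos]
        with r h2 h3 h4
      rw [← h2]
      have h5 : 1 ≤ F r ^ (1 - α) :=
        Real.one_le_rpow_of_pos_of_le_one_of_nonpos h4 measureReal_le_one (by linarith)
      refine mul_le_mul h3.le ?_ hs.le (by linarith)
      exact le_mul_of_one_le_right hs.le h5
  have hqU : ∀ᶠ J in atTop,
      Tendsto (fun r => μ.real (U r ∩ avoid T (U r) J) / μ.real (U r)) (𝓝[>] 0) (𝓝 L) := by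
    filter_upwards [hq] with J hJ
    exact tendsto_inter_avoid_of_nested h.preserving
      (Eventually.of_forall fun r => h.measurableSet_of_cylinderAlgebra (hU r))
      (Eventually.of_forall fun r => measurableSet_rball r) hpos hnest hratio hJ
  obtain ⟨hg, hrate⟩ := h.tendsto_rate hK hL hU hUK hUpos hqU httop hdich
  refine ⟨hg, ?_⟩
  have h1 := hrate.mul hone
  rw [mul_one] at h1
  refine h1.congr' ?_
  filter_upwards [hprod, hpos, hUpos, httop.eventually_gt_atTop 0] with r h1 h2 h3 h4
  have h4 : (0 : ℝ) < t r := by exact_mod_cast h4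
  have h5 : 0 < s * F r ^ (1 - α) := mul_pos hs (Real.rpow_pos_of_pos h2 _)
  rw [div_mul_eq_mul_div, div_eq_div_iff (by positivity) h5.ne', mul_assoc, h1]

/-- The recurrence rate for `α > 0`, from the extremal index of the balls. -/
theorem hasRecurrenceLimit {L α s : ℝ} (hL : 0 < L) (hα : 0 < α) (hs : 0 < s)
    (hq : ∀ᶠ J in atTop, Tendsto
      (fun r => μ.real (rball z r ∩ avoid T (rball z r) J) / μ.real (rball z r)) (𝓝[>] 0) (𝓝 L)) :
    HasRecurrenceLimit μ T z α s L := by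
  have hc := h.c_pos
  obtain ⟨hgi, hi⟩ := h.tendsto_rate_of_nested (U := fun r => innerApprox T A z (order κ v r) r)
    one_pos hL hα hs (fun r => measurableSet_innerApprox _ _)
    (Eventually.of_forall fun r => by simpa using innerApprox_subset _ _)
    (Eventually.of_forall fun r => Or.inl (innerApprox_subset _ _))
    (h.tendsto_innerApprox fun r hr => order_spec h.κ_pos hr) hq
  obtain ⟨hgo, ho⟩ := h.tendsto_rate_of_nested (U := fun r => outerApprox T A z (order κ v r) r)
    (K := 1 + c) (by positivity) hL hα hs (fun r => measurableSet_outerApprox _ _)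
    (by
      have h1 : ∀ᶠ r in 𝓝[>] (0 : ℝ), r < 1 := nhdsWithin_le_nhds (gt_mem_nhds one_pos)
      filter_upwards [h1, self_mem_nhdsWithin] with r hr1 hr
      have hr : 0 < r := hr
      refine (h.outerApprox_subset_rball hr (order_spec h.κ_pos hr)).trans (rball_mono ?_)
      have h2 : r ^ v ≤ r := by
        simpa using Real.rpow_le_rpow_of_exponent_ge hr hr1.le h.one_lt_v.le
      nlinarith)
    (Eventually.of_forall fun r => Or.inr (subset_outerApprox h.partition.iUnion_eq _ _))
    (h.tendsto_outerApprox fun r hr => order_spec h.κ_pos hr) hq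
  have hrw : ∀ r, recurrenceRate μ T α s (rball z r) =
      -Real.log (μ.real (avoid T (rball z r) ⌊s * μ.real (rball z r) ^ (-α)⌋₊)) /
        (s * μ.real (rball z r) ^ (1 - α)) := fun r => by
    rw [recurrenceRate, survival_eq _ (by positivity)]
    ring
  unfold HasRecurrenceLimit
  simp only [hrw]
  refine tendsto_of_tendsto_of_tendsto_of_le_of_le' hi ho ?_ ?_
  -- The outer set has the smallest survival probability; its positivity makes all the logarithms
  -- comparable.
  · filter_upwards [hgo] with r hgo
    refine div_le_div_of_nonneg_right (neg_le_neg (Real.log_le_log ?_ (measureReal_mono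
      (avoid_anti_set (innerApprox_subset _ _) _)))) (by positivity)
    exact hgo.trans_le (measureReal_mono
      (avoid_anti_set (subset_outerApprox h.partition.iUnion_eq _ _) _))
  · filter_upwards [hgo] with r hgo
    exact div_le_div_of_nonneg_right (neg_le_neg (Real.log_le_log hgo (measureReal_mono
      (avoid_anti_set (subset_outerApprox h.partition.iUnion_eq _ _) _)))) (by positivity)

/-- The recurrence rate for `α = 0`, from the extremal index of the balls. -/
theorem hasRecurrenceLimitZero {L : ℝ} {q : ℕ → ℝ}
    (hq : ∀ J, Tendsto (fun r => μ.real (rball z r ∩ avoid T (rball z r) J) / μ.real (rball z r))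
      (𝓝[>] 0) (𝓝 (q J))) (hqL : Tendsto q atTop (𝓝 L)) : HasRecurrenceLimitZero μ T z L := by
  -- For fixed s the sum for 1 - g(⌊s⌋) has finitely many terms and can be passed to the limit term
  -- by term; as s → ∞ its mean converges by Cesàro.
  refine ⟨fun s => (∑ i ∈ Finset.range ⌊s⌋₊, q i) / s, fun s hs => ?_, ?_⟩
  · have hx : Tendsto (fun r => (1 - μ.real (avoid T (rball z r) ⌊s⌋₊)) / μ.real (rball z r))
        (𝓝[>] 0) (𝓝 (∑ i ∈ Finset.range ⌊s⌋₊, q i)) := by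
      simp only [one_sub_measureReal_avoid h.preserving (measurableSet_rball _), Finset.sum_div]
      exact tendsto_finsetSum _ fun i _ => hq i
    have h1 := ((tendsto_neg_log_div h.eventually_pos
      (tendsto_nhdsWithin_iff.1 h.tendsto_measureReal_rball).1 hx).2).div_const s
    refine h1.congr fun r => ?_
    rw [recurrenceRate, neg_zero, Real.rpow_zero, mul_one, survival_eq _ hs.le, sub_zero,
      Real.rpow_one]
    field_simp
  · have h1 := (hqL.cesaro.comp tendsto_nat_floor_atTop).mul
      (tendsto_nat_floor_div_atTop (R := ℝ))
    rw [mul_one] at h1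
    refine h1.congr' ?_
    filter_upwards [eventually_ge_atTop 1] with s hs
    have h2 : (⌊s⌋₊ : ℝ) ≠ 0 := by
      have := Nat.floor_pos.2 hs
      positivity
    simp only [Function.comp_apply]
    field_simp

end BallMixing

/-- The extremal index of the balls around a periodic point. -/
lemma tendsto_inter_avoid_of_periodic [OpensMeasurableSpace Ω] (hμ : MeasurePreserving T μ μ)
    (hT : Continuous T) (hpos : ∀ᶠ r in 𝓝[>] (0 : ℝ), 0 < μ.real (rball z r)) {p : ℕ} (hp : 0 < p)
    (hpz : Function.minimalPeriod T z = p) {N : ℝ → ℕ} {U : ℝ → Set Ω}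
    (hU : ∀ r, MeasurableSet (U r)) (hUB : ∀ r, U r ⊆ rball z r)
    (hratio : Tendsto (fun r => μ.real (U r) / μ.real (rball z r)) (𝓝[>] 0) (𝓝 1))
    (hnest : NestedReturns μ T p N U) {θ : ℝ}
    (hθ : Tendsto (fun r : ℝ => μ.real (rball z r ∩ T^[p] ⁻¹' rball z r) / μ.real (rball z r))
      (𝓝[>] 0) (𝓝 θ)) {J : ℕ} (hJ : p ≤ J) :
    Tendsto (fun r => μ.real (rball z r ∩ avoid T (rball z r) J) / μ.real (rball z r))
      (𝓝[>] 0) (𝓝 (1 - θ)) := by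
  obtain ⟨a, e, -, haN, he, hret⟩ := hnest
  have hdisj : ∀ᶠ r in 𝓝[>] (0 : ℝ), ∀ j ∈ Finset.Icc 1 J, ¬ p ∣ j →
      ∀ x ∈ rball z r, T^[j] x ∉ rball z r := by
    refine (Filter.eventually_all_finset _).2 fun j _ => ?_
    by_cases hj : p ∣ j
    · exact Eventually.of_forall fun r h => absurd hj h
    · have : T^[j] z ≠ z := fun hz => hj (hpz ▸ Function.IsPeriodicPt.minimalPeriod_dvd hz)
      exact (eventually_disjoint_rball hT this).mono fun r hr _ => hr
  have hup : Tendsto (fun r => 1 - μ.real (rball z r ∩ T^[p] ⁻¹' rball z r) / μ.real (rball z r))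
      (𝓝[>] 0) (𝓝 (1 - θ)) := hθ.const_sub 1
  have hlow : Tendsto (fun r => 1 - μ.real (rball z r ∩ T^[p] ⁻¹' rball z r) / μ.real (rball z r) -
      J * (2 * (1 - μ.real (U r) / μ.real (rball z r)) + |e r|)) (𝓝[>] 0) (𝓝 (1 - θ)) := by
    have := hup.sub ((((hratio.const_sub 1).const_mul 2).add he.abs).const_mul (J : ℝ))
    simpa using this
  have hm := fun r => measurableSet_rball (z := z) r
  have hdiff : ∀ r, μ.real (rball z r \ T^[p] ⁻¹' rball z r) =
      μ.real (rball z r) - μ.real (rball z r ∩ T^[p] ⁻¹' rball z r) := fun r => by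
    have := measureReal_inter_add_sdiff (μ := μ) (s := rball z r)
      (hμ.measurable.iterate p (hm r))
    linarith
  refine tendsto_of_tendsto_of_tendsto_of_le_of_le' hlow hup ?_ ?_
  · filter_upwards [hpos, hdisj, haN.eventually_ge_atTop (J : ℝ), self_mem_nhdsWithin]
      with r hpos hdisj haN hr
    have hr : 0 < r := hr
    -- A point not returning at p either avoids the ball up to J or returns at some j ≤ J. For p ∤ j
    -- the latter is impossible on small balls; for p ∣ j it is negligible.
    have hsub : rball z r \ T^[p] ⁻¹' rball z r ⊆ (rball z r ∩ avoid T (rball z r) J) ∪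
        ⋃ j ∈ Finset.Icc 1 J, (rball z r ∩ T^[j] ⁻¹' rball z r) \ T^[p] ⁻¹' rball z r := by
      rintro x ⟨h1, h2⟩
      by_cases hx : x ∈ avoid T (rball z r) J
      · exact Or.inl ⟨h1, hx⟩
      simp only [avoid, mem_ofPred_eq, not_forall, not_not] at hx
      obtain ⟨j, hj1, hj2, hj⟩ := hx
      exact Or.inr (mem_biUnion (x := j) (Finset.mem_coe.2 (Finset.mem_Icc.2 ⟨hj1, hj2⟩))
        ⟨⟨h1, hj⟩, h2⟩)
    have hterm : ∀ j ∈ Finset.Icc 1 J,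
        μ.real ((rball z r ∩ T^[j] ⁻¹' rball z r) \ T^[p] ⁻¹' rball z r) ≤
          2 * (μ.real (rball z r) - μ.real (U r)) + |e r| * μ.real (rball z r) := by
      intro j hj
      by_cases hpj : p ∣ j
      · obtain ⟨u, rfl⟩ := hpj
        obtain ⟨hj1, hj2⟩ := Finset.mem_Icc.1 hj
        have hu : 1 ≤ u := Nat.pos_of_ne_zero fun h => by simp [h] at hj1
        refine measureReal_return_diff_le hμ (hU r) (hm r) (hUB r) hu ?_
        -- The condition is needed only for the pair of times 0 and pu; pu ≤ J ≤ a_r N(r) for small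
        -- r.
        have h1 := hret r hr 1 ![0, p * u] rfl
          (by rw [Fin.strictMono_iff_lt_succ]; intro i; fin_cases i; exact hj1)
          (by intro i; fin_cases i <;> simp)
          (le_trans (by simpa using (Nat.cast_le (α := ℝ)).2 hj2) haN)
        have h2 : (⋂ i : Fin (1 + 1), T^[(![0, p * u] : Fin 2 → ℕ) i] ⁻¹' U r) =
            U r ∩ T^[p * u] ⁻¹' U r := by
          ext x; simp [Fin.forall_fin_two]
        rw [h2] at h1
        have h3 : (![0, p * u] : Fin 2 → ℕ) (Fin.last 1) / p = u :=
          Nat.mul_div_cancel_left u hp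
        rwa [h3] at h1
      · have : rball z r ∩ T^[j] ⁻¹' rball z r = ∅ :=
          eq_empty_of_forall_notMem fun x hx => hdisj j hj hpj x hx.1 hx.2
        rw [this, empty_sdiff, measureReal_empty]
        have := measureReal_mono (μ := μ) (hUB r)
        have : 0 ≤ |e r| * μ.real (rball z r) := by positivity
        linarith
    have h1 := (measureReal_mono (μ := μ) hsub).trans (measureReal_union_le _ _)
    have h2 := (measureReal_biUnion_finset_le (μ := μ) (Finset.Icc 1 J) fun j =>
      (rball z r ∩ T^[j] ⁻¹' rball z r) \ T^[p] ⁻¹' rball z r).trans (Finset.sum_le_sum hterm)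
    rw [Finset.sum_const, Nat.card_Icc, Nat.add_sub_cancel, nsmul_eq_mul] at h2
    rw [hdiff] at h1
    rw [le_div_iff₀ hpos]
    calc _ = μ.real (rball z r) - μ.real (rball z r ∩ T^[p] ⁻¹' rball z r) -
        J * (2 * (μ.real (rball z r) - μ.real (U r)) + |e r| * μ.real (rball z r)) := by
          field_simp
      _ ≤ _ := by linarith
  · filter_upwards [hpos] with r hpos
    rw [one_sub_div hpos.ne', ← hdiff]
    refine div_le_div_of_nonneg_right (measureReal_mono ?_) measureReal_nonneg
    exact fun x hx => ⟨hx.1, hx.2 p hp hJ⟩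

end Recurrence

end HittingStats

end

/-! ### The main theorem. -/

theorem mainTheorem3 {k : ℕ} {Ω : Type*} [EMetricSpace Ω]
    [ChartedSpace (EuclideanSpace ℝ (Fin k)) Ω] [IsManifold (𝓡 k) ∞ Ω]
    [Bundle.RiemannianBundle (fun x : Ω => TangentSpace (𝓡 k) x)]
    [IsContMDiffRiemannianBundle (𝓡 k) ∞ (EuclideanSpace ℝ (Fin k))
      (fun x : Ω => TangentSpace (𝓡 k) x)]
    [IsRiemannianManifold (𝓡 k) Ω]
    [MeasurableSpace Ω] [BorelSpace Ω]
    -- the map and the invariant measure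
    (T : Ω → Ω) (ζ : ℝ) (hζ₀ : 0 < ζ) (hζ₁ : ζ ≤ 1) (hT : HittingStats.IsC1Holder k ζ T)
    (μ : Measure Ω) [IsProbabilityMeasure μ] (hμ : MeasurePreserving T μ μ)
    -- right `φ`-mixing at polynomial rate `m`
    (A : ℕ → Set Ω) (hA : HittingStats.IsMeasurablePartition A)
    (φ : ℕ → ℝ) (hmix : HittingStats.IsRightPhiMixing μ T A φ)
    (m : ℝ) (hm : 0 < m) (hφ : φ =O[atTop] fun j : ℕ => (j : ℝ) ^ (-m))
    -- diameters of cylinders, annulus condition, measure of balls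
    (κ' c₁ v d : ℝ) (hv : 1 < v) (hd : 0 < d) (hκ : 1 < κ' * d / v)
    (hdiam : ∀ n : ℕ, 1 ≤ n → ∀ C ∈ HittingStats.cylinders T A n,
      Metric.ediam C ≤ ENNReal.ofReal (c₁ * (n : ℝ) ^ (-κ')))
    (hannulus : ∀ z : Ω, Tendsto
      (fun r : ℝ => μ.real (HittingStats.rball z (r + r ^ v)) / μ.real (HittingStats.rball z r))
      (𝓝[>] 0) (𝓝 1))
    (hball : ∀ z : Ω,
      (fun r : ℝ => μ.real (HittingStats.rball z r)) =O[𝓝[>] 0] fun r : ℝ => r ^ d)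
    -- the order of the cylinders that approximate the ball of radius `r`
    (N : ℝ → ℕ) (hN : ∀ r : ℝ, 0 < r → 1 ≤ N r ∧ (N r : ℝ) ^ (-κ') ≤ r ^ v)
    (z : Ω) :
    (z ∉ Function.periodicPts T →
      (∀ α : ℝ, 0 < α →
        (∃ ε β : ℝ, 0 < ε ∧ ε < min 1 α ∧ 0 < β ∧ β < 1 ∧ (1 - ε) / (β * ε) < m) →
        ∀ s : ℝ, 0 < s → HittingStats.HasRecurrenceLimit μ T z α s 1) ∧
      HittingStats.HasRecurrenceLimitZero μ T z 1) ∧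
    (∀ p : ℕ, 0 < p → Function.minimalPeriod T z = p →
      HittingStats.NestedReturns μ T p N
        (fun r => HittingStats.innerApprox T A z (N r) r) →
      HittingStats.NestedReturns μ T p N
        (fun r => HittingStats.outerApprox T A z (N r) r) →
      ∀ θ : ℝ, θ < 1 / 2 →
        Tendsto (fun r : ℝ =>
          μ.real (HittingStats.rball z r ∩ T^[p] ⁻¹' HittingStats.rball z r) /
            μ.real (HittingStats.rball z r)) (𝓝[>] 0) (𝓝 θ) →
        (∀ α : ℝ, 0 < α →
          (∃ ε β : ℝ, 0 < ε ∧ ε < min 1 α ∧ 0 < β ∧ β < 1 ∧ (1 - ε) / (β * ε) < m) →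
          ∀ s : ℝ, 0 < s → HittingStats.HasRecurrenceLimit μ T z α s (1 - θ)) ∧
        HittingStats.HasRecurrenceLimitZero μ T z (1 - θ)) := by
  have hcont : Continuous T := hT.1.continuous
  have hdv : v < κ' * d := by
    rwa [one_lt_div (by linarith)] at hκ
  have hκ0 : 0 < κ' := pos_of_mul_pos_left (lt_trans (by linarith) hdv) hd.le
  -- The constant c₁ has no assumed sign, so it is enlarged to a positive one.
  have h : HittingStats.BallMixing μ T A φ κ' (|c₁| + 1) v d z :=
    { preserving := hμ
      partition := hA
      mixing := hmix
      κ_pos := hκ0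
      c_pos := by positivity
      one_lt_v := hv
      d_pos := hd
      v_lt := hdv
      diam := fun n hn C hC => (hdiam n hn C hC).trans (ENNReal.ofReal_le_ofReal (by
        gcongr
        linarith [le_abs_self c₁]))
      annulus := hannulus z
      ball := hball z }
  have hpos := h.eventually_pos
  have hone : ∀ J : ℕ, (∀ j, 1 ≤ j → j ≤ J → T^[j] z ≠ z) → Tendsto (fun r =>
      μ.real (HittingStats.rball z r ∩ HittingStats.avoid T (HittingStats.rball z r) J) /
        μ.real (HittingStats.rball z r)) (𝓝[>] 0) (𝓝 1) := by
    intro J hJ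
    refine tendsto_const_nhds.congr' ?_
    filter_upwards [hpos, HittingStats.eventually_inter_avoid_rball hcont hJ] with r hr h1
    rw [h1, div_self hr.ne']
  refine ⟨fun hz => ?_, fun p hp hpz hin _ θ hθ hlim => ?_⟩
  · have hq := fun J => hone J fun j hj _ hjz => hz ⟨j, hj, hjz⟩
    exact ⟨fun α hα _ s hs => h.hasRecurrenceLimit one_pos hα hs (Eventually.of_forall hq),
      h.hasRecurrenceLimitZero hq tendsto_const_nhds⟩
  · have hq : ∀ J, p ≤ J → _ := fun J hJ => HittingStats.tendsto_inter_avoid_of_periodic hμ hcont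
      hpos hp hpz
      (fun r => h.measurableSet_of_cylinderAlgebra (HittingStats.measurableSet_innerApprox _ _))
      (fun r => HittingStats.innerApprox_subset _ _) (h.tendsto_innerApprox hN) hin hlim hJ
    refine ⟨fun α hα _ s hs => h.hasRecurrenceLimit (by linarith) hα hs
      ((eventually_ge_atTop p).mono hq),
      -- Before time p small balls have no returns, so the limit is 1 there; from p on it is 1 - θ.
      h.hasRecurrenceLimitZero (q := fun J => if J < p then 1 else 1 - θ) (fun J => ?_) ?_⟩
    · split_ifs with hJ
      · refine hone J fun j hj1 hj2 hjz => ?_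
        have := Nat.le_of_dvd hj1 (hpz ▸ Function.IsPeriodicPt.minimalPeriod_dvd hjz)
        omega
      · exact hq J (not_lt.1 hJ)
    · refine tendsto_const_nhds.congr' ?_
      filter_upwards [eventually_ge_atTop p] with J hJ
      rw [if_neg (not_lt.2 hJ)]
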